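/- **Setting.** Let $\mathcal X\subset\mathbb R^{d}$ be compact, and let $k$ be a (measurable) positive semidefinite kernel on $\mathcal X$ with $k(x,x)\le 1$ and reproducing kernel Hilbert space (RKHS) $\mathcal H_k$. Let $f\in\mathcal H_k$ with $\|f\|_k\le B$ be the unknown utility, with a maximizer $x^\star$. Let $s(a)=(1+e^{-a})^{-1}$, $\dot s=s(1-s)$, $L=\sup_{|a|\le 2B}\dot s(a)$, $\kappa=\sup_{|a|\le 2B}1/\dot s(a)$, and let $\lambda>0$. If the pair $(x_t,x'_t)$ is played in round $t$, a binary feedback $y_t$ is observed, which given the past and the pair equals $1$ with probability $s(f(x_t)-f(x'_t))$. The dueling regret is $$R^{\mathrm D}(T)=\sum_{t=1}^T\tfrac12\big(s(f(x^\star)-f(x_t))+s(f(x^\star)-f(x'_t))-1\big).$$ Let $k^{\mathrm D}((x_1,x_1'),(x_2,x_2'))=k(x_1,x_2)+k(x_1',x_2')-k(x_1,x_2')-k(x_1',x_2)$ be the dueling kernel on $\mathcal X\times\mathcal X$, with RKHS $\mathcal H_{k^{\mathrm D}}$ and features $\psi(z)=k^{\mathrm D}(\cdot,z)$. Put $$\gamma_t=\sup_{x_1,\dots,x_t}\tfrac12\log\det\big(I_t+(\lambda\kappa)^{-1}[k(x_i,x_j)]_{i,j\le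 t}\big),$$ let $\gamma^{\mathrm D}_t$ be the same quantity for $k^{\mathrm D}$, and let $$\beta^{\mathrm D}_t(\delta)=4LB+2L\sqrt{\tfrac{2\kappa}{\lambda}\big(\gamma_t^{\mathrm D}+\log(1/\delta)\big)} .$$ **Quantities of round $t$.** They are computed from the $t-1$ earlier pairs $z_\tau=(x_\tau,x'_\tau)$ and feedbacks $y_\tau$, $\tau<t$. * The width is $\sigma_t^{\mathrm D}\ge 0$ with $\sigma^{\mathrm D}_t(z)^2=k^{\mathrm D}(z,z)-\mathbf k(z)^\top(K+\lambda\kappa I)^{-1}\mathbf k(z)$, where $K=[k^{\mathrm D}(z_i,z_j)]_{i,j<t}$ and $\mathbf k(z)=(k^{\mathrm D}(z_i,z))_{i<t}$. * The estimate $h_t$ is the logistic estimate projected to the $B$-ball. Let $\theta_t$ minimize $\sum_{\tau<t}\{-y_\tau\log s(\theta(z_\tau))-(1-y_\tau)\log(1-s(\theta(z_\tau)))\}+\tfrac\lambda2\|\theta\|^2$ over $\mathcal H_{k^{\mathrm D}}$, let $g_t(\theta)=\sum_{\tau<t}s(\theta(z_\tau))\psi(z_\tau)+\lambda\theta$ and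 $V_t=\sum_{\tau<t}\psi(z_\tau)\psi(z_\tau)^\top+\lambda\kappa I$. Then $h_t$ minimizes $\|g_t(\theta)-g_t(\theta_t)\|_{V_t^{-1}}$ over $\|\theta\|\le B$. In particular, $h_t=\theta_t$ if $\|\theta_t\|\le B$. **Algorithm (preference-based IDS).** Fix $x_{\rm null}\in\mathcal X$ and exploration coefficients $\tilde\beta_t$. In round $t$ put $x^{(1)}_t\in\arg\max_x h_t(x,x_{\rm null})$, $u_t=\sup_{x}\{h_t(x,x_t^{(1)})+\tilde\beta_t\sigma^{\mathrm D}_t(x,x_t^{(1)})\}$ and $\hat\Delta_t(x)=u_t+h_t(x_t^{(1)},x)$, and choose $$(x_t^{(2)},p_t)\in\arg\min_{x\in\mathcal X,\;p\in[0,1]}\frac{\big((1-p)u_t+p\hat\Delta_t(x)\big)^2}{p\log\big(1+(\lambda\kappa)^{-1}\sigma^{\mathrm D}_t(x_t^{(1)},x)^2\big)},$$ where $a/0=\infty$ for $a>0$ and $0/0=0$. Draw $\alpha_t\sim\mathrm{Bern}(p_t)$ given the past. Play $(x_t,x_t')=(x^{(1)}_t,x^{(2)}_t)$ if $\alpha_t=1$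 and $(x^{(1)}_t,x^{(1)}_t)$ otherwise. Observe $y_t$. **Theorem.** For all $B$ and $\lambda>0$ there is a constant $C$, depending only on $B$ and $\lambda$, such that the following holds for all $d,\mathcal X,k,f$ as above and every $\delta\in(0,1]$. Every run of the preference-based IDS algorithm with exploration coefficients $\tilde\beta_t=\beta^{\mathrm D}_t(\delta)/L$ for $t\ge1$ satisfies $$\mathbb P\Big(\forall T\ge 0:\; R^{\mathrm D}(T)\le C\,\beta^{\mathrm D}_T(\delta)\sqrt{T\big(\gamma_T+\log (1/\delta)\big)}\Big)\ge 1-\delta ,$$ and on the same event the bound also holds with $\gamma^{\mathrm D}_T$ in place of $\gamma_T$. -/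

import Mathlib

open MeasureTheory ProbabilityTheory

namespace DuelingIDS

/-! ## Constants of the sigmoid -/

/-- Derivative of the sigmoid `s`, namely `s (1 - s)`. -/
noncomputable def sigmoidDeriv (a : ℝ) : ℝ := Real.sigmoid a * (1 - Real.sigmoid a)

/-- Supremum over `|a| ≤ R` of the reciprocal of the derivative of the sigmoid. -/
noncomputable def sigmoidKappa (R : ℝ) : ℝ :=
  sSup ((fun a => 1 / sigmoidDeriv a) '' Set.Icc (-R) R)

/-- Supremum over `|a| ≤ R` of the derivative of the sigmoid. -/
noncomputable def sigmoidLip (R : ℝ) : ℝ :=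
  sSup (sigmoidDeriv '' Set.Icc (-R) R)

/-! ## Kernels: posterior variance, information gain, confidence coefficient -/

section Kernel

variable {Z : Type*}

/-- Kernel matrix of a finite family of points. -/
def kernelMatrix (k : Z → Z → ℝ) {t : ℕ} (z : Fin t → Z) : Matrix (Fin t) (Fin t) ℝ :=
  Matrix.of fun i j => k (z i) (z j)

/-- Posterior variance `k(w,w) - k_t(w)ᵀ (K_t + ρ I)⁻¹ k_t(w)` after observing the first `t` points
of the sequence `z`. -/
noncomputable def posteriorVar (k : Z → Z → ℝ) (ρ : ℝ) (t : ℕ) (z : ℕ → Z) (w : Z) : ℝ :=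
  k w w - (fun i : Fin t => k (z i) w) ⬝ᵥ
    (((kernelMatrix k fun i : Fin t => z i) + ρ • (1 : Matrix (Fin t) (Fin t) ℝ))⁻¹).mulVec
      (fun i : Fin t => k (z i) w)

/-- Posterior standard deviation. -/
noncomputable def posteriorStd (k : Z → Z → ℝ) (ρ : ℝ) (t : ℕ) (z : ℕ → Z) (w : Z) : ℝ :=
  √(posteriorVar k ρ t z w)

/-- Maximal information gain over `t` points: the supremum of `(1/2) log det (I + ρ⁻¹ K)`. -/
noncomputable def infoGain (k : Z → Z → ℝ) (ρ : ℝ) (t : ℕ) : ℝ :=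
  ⨆ z : Fin t → Z,
    (1 / 2 : ℝ) * Real.log ((1 : Matrix (Fin t) (Fin t) ℝ) + ρ⁻¹ • kernelMatrix k z).det

/-- The coefficient `4 L B + 2 L √((2 κ / lam) (γ_t + log (1/δ)))`. -/
noncomputable def confCoef (k : Z → Z → ℝ) (L κ lam B δ : ℝ) (t : ℕ) : ℝ :=
  4 * L * B + 2 * L * √(2 * κ / lam * (infoGain k (lam * κ) t + Real.log (1 / δ)))

/-- The dueling kernel on pairs. -/
def duelingKernel {X : Type*} (k : X → X → ℝ) (a b : X × X) : ℝ :=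
  k a.1 b.1 + k a.2 b.2 - k a.1 b.2 - k a.2 b.1

end Kernel

/-! ## Kernelized logistic regression -/

section Estimator

variable {Z H : Type*} [NormedAddCommGroup H] [InnerProductSpace ℝ H] [CompleteSpace H]
  [RKHS ℝ H Z ℝ]

variable (H) in
/-- The real-valued reproducing kernel of a space of real functions. -/
noncomputable def scalarKernel (a b : Z) : ℝ := RKHS.kernel H a b 1

variable (H) in
/-- The feature `φ(z) = k(·, z)`. -/
noncomputable def feature (z : Z) : H := RKHS.kerFun H z 1

/-- Regularized negative log-likelihood of the first `t` observations. -/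
noncomputable def logisticLoss (lam : ℝ) (t : ℕ) (z : ℕ → Z) (y : ℕ → ℝ) (h : H) : ℝ :=
  (∑ τ ∈ Finset.range t,
    (-(y τ) * Real.log (Real.sigmoid (h (z τ)))
      - (1 - y τ) * Real.log (1 - Real.sigmoid (h (z τ))))) + lam / 2 * ‖h‖ ^ 2

/-- `h` minimizes the regularized negative log-likelihood over the whole space. -/
def IsLogisticMinimizer (lam : ℝ) (t : ℕ) (z : ℕ → Z) (y : ℕ → ℝ) (h : H) : Prop :=
  ∀ g : H, logisticLoss lam t z y h ≤ logisticLoss lam t z y g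

/-- `g_t(θ) = ∑ s(θ(z_τ)) φ(z_τ) + lam θ`. -/
noncomputable def gradMap (lam : ℝ) (t : ℕ) (z : ℕ → Z) (h : H) : H :=
  (∑ τ ∈ Finset.range t, Real.sigmoid (h (z τ)) • feature H (z τ)) + lam • h

variable (H) in
/-- `V_t = ∑ φ(z_τ) ⟨φ(z_τ), ·⟩ + ρ I`. -/
noncomputable def covOp (ρ : ℝ) (t : ℕ) (z : ℕ → Z) : H →L[ℝ] H :=
  (∑ τ ∈ Finset.range t, (innerSL ℝ (feature H (z τ))).smulRight (feature H (z τ)))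
    + ρ • ContinuousLinearMap.id ℝ H

/-- The norm `‖v‖_{V_t⁻¹} = √⟨v, V_t⁻¹ v⟩`. For `ρ > 0` the operator `V_t` is invertible. -/
noncomputable def invCovNorm (ρ : ℝ) (t : ℕ) (z : ℕ → Z) (v : H) : ℝ :=
  √(inner ℝ v (Ring.inverse (covOp H ρ t z) v))

/-- `h` is the logistic estimate from the first `t` observations, projected to the ball of
radius `B`: it minimizes `‖g_t(θ) - g_t(θ_t)‖_{V_t⁻¹}` over `‖θ‖ ≤ B`, where `θ_t` is the minimizer
of the loss. If `‖θ_t‖ ≤ B`, it is `θ_t` itself. -/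
def IsProjectedEstimate (B lam κ : ℝ) (t : ℕ) (z : ℕ → Z) (y : ℕ → ℝ) (h : H) : Prop :=
  ∃ θ : H, IsLogisticMinimizer lam t z y θ ∧ ‖h‖ ≤ B ∧
    ∀ g : H, ‖g‖ ≤ B →
      invCovNorm (lam * κ) t z (gradMap lam t z h - gradMap lam t z θ) ≤
        invCovNorm (lam * κ) t z (gradMap lam t z g - gradMap lam t z θ)

end Estimator

/-! ## One round of the algorithm -/

section Round

variable {X : Type*}

/-- `u = max_x h(x, x₁) + b σ(x, x₁)`. -/
noncomputable def optimisticGain (h σ : X × X → ℝ) (b : ℝ) (x₁ : X) : ℝ :=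
  ⨆ x : X, (h (x, x₁) + b * σ (x, x₁))

/-- Estimated gap `u + h(x₁, x)`. -/
noncomputable def estGap (h σ : X × X → ℝ) (b : ℝ) (x₁ x : X) : ℝ :=
  optimisticGain h σ b x₁ + h (x₁, x)

/-- The ratio `((1-p) u + p Δ(x))² / (p log (1 + ρ⁻¹ σ(x₁,x)²))`, valued in `[0,∞]`:
it is `∞` if only the denominator vanishes, and `0/0 = 0`. -/
noncomputable def idsRatio (h σ : X × X → ℝ) (b ρ : ℝ) (x₁ x : X) (p : ℝ) : ENNReal :=
  ENNReal.ofReal (((1 - p) * optimisticGain h σ b x₁ + p * estGap h σ b x₁ x) ^ 2) /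
    ENNReal.ofReal (p * Real.log (1 + ρ⁻¹ * σ (x₁, x) ^ 2))

/-- `x₁` is a greedy action, and `(x₂, p)` minimizes the ratio over `X × [0,1]`. -/
def IsIDSChoice (h σ : X × X → ℝ) (b ρ : ℝ) (xnull x₁ x₂ : X) (p : ℝ) : Prop :=
  (∀ x, h (x, xnull) ≤ h (x₁, xnull)) ∧ p ∈ Set.Icc (0 : ℝ) 1 ∧
    ∀ x, ∀ q ∈ Set.Icc (0 : ℝ) 1, idsRatio h σ b ρ x₁ x₂ p ≤ idsRatio h σ b ρ x₁ x q

end Round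

/-! ## The interaction protocol -/

/-- A binary outcome as a real number. -/
def boolReal (c : Bool) : ℝ := if c then 1 else 0

/-- The interaction of the algorithm with the environment of utility `f`. Index `n` stands for the
round `n + 1`; the σ-algebra `𝒢 n` is the information available before it, and the estimate `h n`
and the width are computed from the `n` observations made before it. The number `b n` is the
exploration coefficient of this round. The sequence `x₁` is the greedy action, `x₂` the informative
action, `p` its selection probability, `α` the coin, `(x, x')` the pair that is played, and `y` the
preference that is observed. -/
structure IsIDSRun {X HD Ω : Type*} [MeasurableSpace X]
    [NormedAddCommGroup HD] [InnerProductSpace ℝ HD] [CompleteSpace HD] [RKHS ℝ HD (X × X) ℝ]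
    {mΩ : MeasurableSpace Ω} (μ : Measure Ω) (𝒢 : Filtration ℕ mΩ)
    (f : X → ℝ) (B lam κ : ℝ) (b : ℕ → ℝ) (xnull : X)
    (h : ℕ → Ω → HD) (x₁ x₂ : ℕ → Ω → X) (p : ℕ → Ω → ℝ) (α : ℕ → Ω → Bool)
    (x x' : ℕ → Ω → X) (y : ℕ → Ω → Bool) : Prop where
  measurable_fst : ∀ n, Measurable[𝒢 n] (x₁ n)
  measurable_snd : ∀ n, Measurable[𝒢 n] (x₂ n)
  measurable_prob : ∀ n, Measurable[𝒢 n] (p n)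
  measurable_coin : ∀ n, Measurable[𝒢 (n + 1)] (α n)
  measurable_feedback : ∀ n, Measurable[𝒢 (n + 1)] (y n)
  estimate : ∀ᵐ ω ∂μ, ∀ n,
    IsProjectedEstimate B lam κ n (fun τ => (x τ ω, x' τ ω)) (fun τ => boolReal (y τ ω)) (h n ω)
  choice : ∀ᵐ ω ∂μ, ∀ n,
    IsIDSChoice (fun z => h n ω z)
      (posteriorStd (scalarKernel HD) (lam * κ) n (fun τ => (x τ ω, x' τ ω)))
      (b n) (lam * κ) xnull (x₁ n ω) (x₂ n ω) (p n ω)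
  coin : ∀ n, μ[fun ω => boolReal (α n ω) | 𝒢 n] =ᵐ[μ] p n
  play_fst : ∀ n ω, x n ω = x₁ n ω
  play_snd : ∀ n ω, x' n ω = if α n ω then x₂ n ω else x₁ n ω
  feedback : ∀ n, μ[fun ω => boolReal (y n ω) | 𝒢 n ⊔ MeasurableSpace.comap (α n) ⊤] =ᵐ[μ]
    fun ω => Real.sigmoid (f (x n ω) - f (x' n ω))

/-- Cumulative dueling regret of the first `T` rounds against the action `xs`. -/
noncomputable def duelingRegret {X : Type*} (f : X → ℝ) (xs : X) (x x' : ℕ → X) (T : ℕ) : ℝ :=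
  ∑ n ∈ Finset.range T,
    (Real.sigmoid (f xs - f (x n)) + Real.sigmoid (f xs - f (x' n)) - 1) / 2

end DuelingIDS

/-! Regret is paid for by information. Put F(x,x') = f(x) - f(x') and ρ = lam κ, and let I = log(1 +
σ²/ρ) be the information in the pair (x⁽¹⁾, x⁽²⁾). Suppose that h is within bσ of F, with b = β/L.
Then the minimized ratio is O(b²), because a near-maximizer of the optimistic gain, taken with p =
1, has estimated gap at most 2bσ (`sq_le_of_isIDSChoice`). Hence the gap of x⁽¹⁾ and p times the gap
of x⁽²⁾ are O(b √(pI)) (`gaps_le_of_isIDSChoice`), and Cauchy–Schwarz over the rounds leaves √(T ∑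
pI). The collected information ∑ αI is at most a log-determinant, hence at most twice the dueling
information gain (`log_det_eq_sum`). Multiplicative Bernoulli tail bounds exchange α and p at the
cost of a logarithm.

For the confidence bound, monotonicity of the gradient map reduces the error of h to the norm ‖S‖ of
the noise sum S in the inverse covariance (`abs_estimate_sub_le`). The process exp(2‖S‖²)/√det(1 +
K/ρ) is a supermartingale. Its one-step inequality `bernoulli_selfNorm_le` is a mixture over a
one-dimensional Gaussian, so no Gaussian measure on the RKHS is needed. Ville's inequality for the
sum of this process and the two coin processes gives a single event with threshold log(3/δ)
(`measure_exists_sum_ge_le`).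

The coefficient β contains only log(1/δ), so the surplus log 3 needs room. If the dueling gain γᴰ at
n + 1 is at least 1, it absorbs the surplus (`abs_estimate_sub_le_confCoef`). If it is at most 1,
the estimate is not used at all: repeating one pair n + 1 times shows that the kernel is O(γᴰ/(n+1))
on the diagonal, so all gaps are O(√(γᴰ/(n+1))) and sum to O(√(T γᴰ)) (`gap_le_of_infoGain_le_one`).
`duelingRegret_le` combines the two regimes on a fixed path. The version with the gain of k itself
follows from the determinant comparison `infoGain_dueling_le`. -/

namespace DuelingIDS

/-! ## The regularized covariance operator -/

section Operator

variable {Z H : Type*} [NormedAddCommGroup H] [InnerProductSpace ℝ H] [CompleteSpace H]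
  [RKHS ℝ H Z ℝ]

lemma inner_feature (h : H) (z : Z) : inner ℝ h (feature H z) = h z := by
  simp [feature]

lemma feature_inner (h : H) (z : Z) : inner ℝ (feature H z) h = h z := by
  rw [real_inner_comm, inner_feature]

lemma scalarKernel_eq_inner (a b : Z) :
    scalarKernel H a b = inner ℝ (feature H a) (feature H b) := by
  rw [feature_inner, scalarKernel, ← RKHS.kerFun_apply, feature]

lemma feature_apply (a b : Z) : feature H b a = scalarKernel H a b := by
  rw [scalarKernel_eq_inner, feature_inner]

lemma scalarKernel_self (a : Z) : scalarKernel H a a = ‖feature H a‖ ^ 2 := by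
  rw [scalarKernel_eq_inner, real_inner_self_eq_norm_sq]

lemma scalarKernel_comm (a b : Z) : scalarKernel H a b = scalarKernel H b a := by
  rw [scalarKernel_eq_inner, scalarKernel_eq_inner, real_inner_comm]

lemma scalarKernel_self_nonneg (a : Z) : 0 ≤ scalarKernel H a a := by
  rw [scalarKernel_self]; positivity

lemma abs_apply_le (h : H) (z : Z) : |h z| ≤ ‖h‖ * √(scalarKernel H z z) := by
  rw [← inner_feature, scalarKernel_self, Real.sqrt_sq (norm_nonneg _)]
  exact abs_real_inner_le_norm _ _

lemma covOp_apply (ρ : ℝ) (t : ℕ) (z : ℕ → Z) (v : H) :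
    covOp H ρ t z v = (∑ τ ∈ Finset.range t, v (z τ) • feature H (z τ)) + ρ • v := by
  simp [covOp, feature_inner]

lemma covOp_succ (ρ : ℝ) (t : ℕ) (z : ℕ → Z) (v : H) :
    covOp H ρ (t + 1) z v = covOp H ρ t z v + v (z t) • feature H (z t) := by
  simp only [covOp_apply, Finset.sum_range_succ]; abel

lemma inner_covOp (ρ : ℝ) (t : ℕ) (z : ℕ → Z) (u v : H) :
    inner ℝ u (covOp H ρ t z v) =
      (∑ τ ∈ Finset.range t, u (z τ) * v (z τ)) + ρ * inner ℝ u v := by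
  simp only [covOp_apply, inner_add_right, inner_sum, inner_smul_right, inner_feature]
  congr 1
  exact Finset.sum_congr rfl fun _ _ => mul_comm _ _

lemma inner_covOp_comm (ρ : ℝ) (t : ℕ) (z : ℕ → Z) (u v : H) :
    inner ℝ u (covOp H ρ t z v) = inner ℝ (covOp H ρ t z u) v := by
  rw [real_inner_comm v, inner_covOp, inner_covOp, real_inner_comm v]
  simp only [mul_comm]

lemma mul_norm_sq_le_inner_covOp (ρ : ℝ) (t : ℕ) (z : ℕ → Z) (u : H) :
    ρ * ‖u‖ ^ 2 ≤ inner ℝ u (covOp H ρ t z u) := by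
  rw [inner_covOp, real_inner_self_eq_norm_sq, le_add_iff_nonneg_left]
  exact Finset.sum_nonneg fun _ _ => mul_self_nonneg _

/-- The quadratic form is coercive with constant ρ. Invertibility matters because `Ring.inverse` has
the junk value 0 on non-units. -/
lemma isUnit_covOp {ρ : ℝ} (hρ : 0 < ρ) (t : ℕ) (z : ℕ → Z) : IsUnit (covOp H ρ t z) := by
  refine ContinuousLinearMap.isUnit_of_forall_le_norm_inner_map _ (c := ⟨ρ, hρ.le⟩) hρ fun u => ?_
  have h := mul_norm_sq_le_inner_covOp ρ t z u
  rw [real_inner_comm] at h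
  calc ‖u‖ ^ 2 * ρ = ρ * ‖u‖ ^ 2 := mul_comm _ _
    _ ≤ _ := h
    _ ≤ _ := Real.le_norm_self _

variable (H) in
/-- The inverse of the regularized covariance operator. -/
noncomputable def covInv (ρ : ℝ) (t : ℕ) (z : ℕ → Z) : H →L[ℝ] H := Ring.inverse (covOp H ρ t z)

lemma covOp_covInv {ρ : ℝ} (hρ : 0 < ρ) (t : ℕ) (z : ℕ → Z) (v : H) :
    covOp H ρ t z (covInv H ρ t z v) = v := by
  have := Ring.mul_inverse_cancel _ (isUnit_covOp (H := H) hρ t z)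
  exact congrArg (fun A : H →L[ℝ] H => A v) this

lemma covInv_covOp {ρ : ℝ} (hρ : 0 < ρ) (t : ℕ) (z : ℕ → Z) (v : H) :
    covInv H ρ t z (covOp H ρ t z v) = v := by
  have := Ring.inverse_mul_cancel _ (isUnit_covOp (H := H) hρ t z)
  exact congrArg (fun A : H →L[ℝ] H => A v) this

lemma inner_covInv_comm {ρ : ℝ} (hρ : 0 < ρ) (t : ℕ) (z : ℕ → Z) (u v : H) :
    inner ℝ u (covInv H ρ t z v) = inner ℝ (covInv H ρ t z u) v := by
  conv_lhs => rw [← covOp_covInv hρ t z u]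
  rw [← inner_covOp_comm, covOp_covInv hρ]

lemma inner_covInv_self_nonneg {ρ : ℝ} (hρ : 0 < ρ) (t : ℕ) (z : ℕ → Z) (v : H) :
    0 ≤ inner ℝ v (covInv H ρ t z v) := by
  have h := mul_norm_sq_le_inner_covOp ρ t z (covInv H ρ t z v)
  rw [covOp_covInv hρ, real_inner_comm] at h
  exact le_trans (by positivity) h

lemma inner_covInv_self_le {ρ : ℝ} (hρ : 0 < ρ) (t : ℕ) (z : ℕ → Z) (v : H) :
    inner ℝ v (covInv H ρ t z v) ≤ ‖v‖ ^ 2 / ρ := by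
  have h := mul_norm_sq_le_inner_covOp ρ t z (covInv H ρ t z v)
  rw [covOp_covInv hρ, real_inner_comm] at h
  have h2 := real_inner_le_norm v (covInv H ρ t z v)
  rw [le_div_iff₀ hρ]
  nlinarith [sq_nonneg (‖v‖ - ρ * ‖covInv H ρ t z v‖)]

/-- Cauchy–Schwarz inequality for the form of the inverse covariance. -/
lemma inner_covInv_sq_le {ρ : ℝ} (hρ : 0 < ρ) (t : ℕ) (z : ℕ → Z) (u v : H) :
    inner ℝ u (covInv H ρ t z v) ^ 2 ≤
      inner ℝ u (covInv H ρ t z u) * inner ℝ v (covInv H ρ t z v) := by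
  have h : ∀ s : ℝ, 0 ≤ inner ℝ v (covInv H ρ t z v) * (s * s)
      + 2 * inner ℝ u (covInv H ρ t z v) * s + inner ℝ u (covInv H ρ t z u) := by
    intro s
    have h := inner_covInv_self_nonneg hρ t z (u + s • v)
    simp only [map_add, map_smul, inner_add_left, inner_add_right, inner_smul_left,
      inner_smul_right] at h
    rw [inner_covInv_comm hρ t z v u, real_inner_comm u] at h
    simp only [conj_trivial] at h
    linarith
  have := discrim_le_zero h
  rw [discrim] at this
  linarith

/-- Cauchy–Schwarz inequality for the pairing of the covariance with its inverse. -/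
lemma inner_sq_le_covOp_mul_covInv {ρ : ℝ} (hρ : 0 < ρ) (t : ℕ) (z : ℕ → Z) (u v : H) :
    inner ℝ u v ^ 2 ≤ inner ℝ u (covOp H ρ t z u) * inner ℝ v (covInv H ρ t z v) := by
  have h := inner_covInv_sq_le hρ t z (covOp H ρ t z u) v
  rwa [covInv_covOp hρ, real_inner_comm u, inner_covInv_comm hρ, covInv_covOp hρ] at h

lemma invCovNorm_sq {ρ : ℝ} (hρ : 0 < ρ) (t : ℕ) (z : ℕ → Z) (v : H) :
    invCovNorm ρ t z v ^ 2 = inner ℝ v (covInv H ρ t z v) :=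
  Real.sq_sqrt (inner_covInv_self_nonneg hρ t z v)

lemma invCovNorm_nonneg (ρ : ℝ) (t : ℕ) (z : ℕ → Z) (v : H) : 0 ≤ invCovNorm ρ t z v :=
  Real.sqrt_nonneg _

lemma invCovNorm_neg (ρ : ℝ) (t : ℕ) (z : ℕ → Z) (v : H) :
    invCovNorm ρ t z (-v) = invCovNorm ρ t z v := by
  simp [invCovNorm]

lemma invCovNorm_add_le {ρ : ℝ} (hρ : 0 < ρ) (t : ℕ) (z : ℕ → Z) (u v : H) :
    invCovNorm ρ t z (u + v) ≤ invCovNorm ρ t z u + invCovNorm ρ t z v := by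
  have hu := invCovNorm_nonneg ρ t z u
  have hv := invCovNorm_nonneg ρ t z v
  refine abs_le_of_sq_le_sq' ?_ (add_nonneg hu hv) |>.2
  have h : inner ℝ u (covInv H ρ t z v) ≤ invCovNorm ρ t z u * invCovNorm ρ t z v := by
    refine abs_le_of_sq_le_sq' ?_ (mul_nonneg hu hv) |>.2
    rw [mul_pow, invCovNorm_sq hρ, invCovNorm_sq hρ]
    exact inner_covInv_sq_le hρ t z u v
  rw [add_sq, invCovNorm_sq hρ, invCovNorm_sq hρ, invCovNorm_sq hρ, map_add, inner_add_left,
    inner_add_right, inner_add_right, inner_covInv_comm hρ t z v u, real_inner_comm u]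
  linarith

lemma invCovNorm_le_norm {ρ : ℝ} (hρ : 0 < ρ) (t : ℕ) (z : ℕ → Z) (v : H) :
    invCovNorm ρ t z v ≤ ‖v‖ / √ρ := by
  rw [invCovNorm, ← Real.sqrt_sq (norm_nonneg v), ← Real.sqrt_div (by positivity)]
  exact Real.sqrt_le_sqrt (inner_covInv_self_le hρ t z v)

/-- Rank-one update of the inverse covariance. -/
lemma covInv_succ {ρ : ℝ} (hρ : 0 < ρ) (t : ℕ) (z : ℕ → Z) (v : H) :
    covInv H ρ (t + 1) z v = covInv H ρ t z v -
      (inner ℝ v (covInv H ρ t z (feature H (z t))) /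
        (1 + inner ℝ (feature H (z t)) (covInv H ρ t z (feature H (z t))))) •
        covInv H ρ t z (feature H (z t)) := by
  set ψ := feature H (z t)
  set w := inner ℝ ψ (covInv H ρ t z ψ) with hw
  have hw0 : 0 ≤ w := inner_covInv_self_nonneg hρ t z ψ
  set m := inner ℝ v (covInv H ρ t z ψ) with hm
  -- Sherman–Morrison, checked by applying the updated operator to the candidate; injectivity then
  -- identifies it.
  have key : covOp H ρ (t + 1) z (covInv H ρ t z v - (m / (1 + w)) • covInv H ρ t z ψ) = v := by
    rw [covOp_succ, map_sub, map_smul, covOp_covInv hρ, covOp_covInv hρ, ← inner_feature,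
      inner_sub_left, inner_smul_left, ← inner_covInv_comm hρ, ← inner_covInv_comm hρ, ← hm, ← hw]
    rw [sub_add_eq_add_sub, add_sub_assoc, ← sub_smul]
    have : m - (starRingEnd ℝ) (m / (1 + w)) * w - m / (1 + w) = 0 := by
      rw [conj_trivial]; field_simp; ring
    rw [this, zero_smul, add_zero]
  rw [← covInv_covOp hρ (t + 1) z (covInv H ρ t z v - _), key]

/-- Effect of one more observation on the self-normalized norm. -/
lemma inner_covInv_succ_add_smul {ρ : ℝ} (hρ : 0 < ρ) (t : ℕ) (z : ℕ → Z) (S : H) (e : ℝ) :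
    inner ℝ (S + e • feature H (z t)) (covInv H ρ (t + 1) z (S + e • feature H (z t))) =
      inner ℝ S (covInv H ρ t z S) +
      (2 * e * inner ℝ S (covInv H ρ t z (feature H (z t)))
        + e ^ 2 * inner ℝ (feature H (z t)) (covInv H ρ t z (feature H (z t)))
        - inner ℝ S (covInv H ρ t z (feature H (z t))) ^ 2) /
        (1 + inner ℝ (feature H (z t)) (covInv H ρ t z (feature H (z t)))) := by
  rw [covInv_succ hρ]
  have hc := inner_covInv_comm hρ t z (feature H (z t)) S
  rw [real_inner_comm S] at hc
  have hw0 : 0 ≤ inner ℝ (feature H (z t)) (covInv H ρ t z (feature H (z t))) :=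
    inner_covInv_self_nonneg hρ t z _
  simp only [map_add, map_smul, inner_add_left, inner_add_right, inner_smul_left,
    inner_smul_right, inner_sub_right, conj_trivial, hc]
  field_simp
  ring

/-! ## The posterior variance -/

lemma posSemidef_kernelMatrix {t : ℕ} (z : Fin t → Z) :
    (kernelMatrix (scalarKernel H) z).PosSemidef := by
  refine Matrix.PosSemidef.of_dotProduct_mulVec_nonneg ?_ fun c => ?_
  · ext i j; simp [kernelMatrix, scalarKernel_comm (z j)]
  · have : star c ⬝ᵥ (kernelMatrix (scalarKernel H) z).mulVec c =
        ‖∑ i, c i • feature H (z i)‖ ^ 2 := by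
      rw [← real_inner_self_eq_norm_sq, sum_inner]
      simp only [inner_sum, inner_smul_left, inner_smul_right, ← scalarKernel_eq_inner, dotProduct,
        Matrix.mulVec, kernelMatrix, Matrix.of_apply, Finset.mul_sum, star_trivial, conj_trivial]
      exact Finset.sum_congr rfl fun i _ => Finset.sum_congr rfl fun j _ => by ring
    rw [this]; positivity

lemma posDef_kernelMatrix_add {ρ : ℝ} (hρ : 0 < ρ) {t : ℕ} (z : Fin t → Z) :
    (kernelMatrix (scalarKernel H) z + ρ • (1 : Matrix (Fin t) (Fin t) ℝ)).PosDef :=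
  (Matrix.PosDef.one.smul hρ).posSemidef_add (posSemidef_kernelMatrix z)

/-- Coefficients of the projection of the feature of `a` in the posterior. -/
noncomputable def posteriorCoef (k : Z → Z → ℝ) (ρ : ℝ) (t : ℕ) (z : ℕ → Z) (a : Z) :
    Fin t → ℝ :=
  (((kernelMatrix k fun i : Fin t => z i) + ρ • (1 : Matrix (Fin t) (Fin t) ℝ))⁻¹).mulVec
      (fun i : Fin t => k (z i) a)

/-- The system (K + ρ)c = k(a) says that the residual of the feature has value ρ cᵢ at zᵢ, so the
covariance operator sends the residual to ρ times the feature. This reduces the operator inverse to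
finite matrices. -/
lemma covInv_feature {ρ : ℝ} (hρ : 0 < ρ) (t : ℕ) (z : ℕ → Z) (a : Z) :
    covInv H ρ t z (feature H a) = ρ⁻¹ • (feature H a -
      ∑ i : Fin t, posteriorCoef (scalarKernel H) ρ t z a i • feature H (z i)) := by
  set c := posteriorCoef (scalarKernel H) ρ t z a with hc
  have hunit := (posDef_kernelMatrix_add (H := H) hρ fun i : Fin t => z i).det_pos.ne'.isUnit
  have hsol : ((kernelMatrix (scalarKernel H) fun i : Fin t => z i)
      + ρ • (1 : Matrix (Fin t) (Fin t) ℝ)).mulVec c = fun i : Fin t => scalarKernel H (z i) a := by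
    rw [hc, posteriorCoef, Matrix.mulVec_mulVec, Matrix.mul_nonsing_inv _ hunit, Matrix.one_mulVec]
  have key : covOp H ρ t z (feature H a - ∑ i : Fin t, c i • feature H (z i)) =
      ρ • feature H a := by
    have h1 : ∀ i : Fin t, (feature H a - ∑ j : Fin t, c j • feature H (z j)) (z i) = ρ * c i := by
      intro i
      have := congrFun hsol i
      rw [Matrix.add_mulVec, Matrix.smul_mulVec, Matrix.one_mulVec, Pi.add_apply, Pi.smul_apply,
        smul_eq_mul] at this
      simp only [Matrix.mulVec, dotProduct, kernelMatrix, Matrix.of_apply] at this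
      rw [← inner_feature, inner_sub_left, sum_inner, real_inner_comm, ← scalarKernel_eq_inner]
      simp only [inner_smul_left, conj_trivial]
      have h2 : ∀ j : Fin t, c j * inner ℝ (feature H (z j)) (feature H (z i)) =
          scalarKernel H (z i) (z j) * c j := fun j => by
        rw [← scalarKernel_eq_inner, scalarKernel_comm]; ring
      rw [Finset.sum_congr rfl fun j _ => h2 j]
      linarith
    rw [covOp_apply, ← Fin.sum_univ_eq_sum_range
      (fun τ => (feature H a - ∑ j : Fin t, c j • feature H (z j)) (z τ) • feature H (z τ)),
      Finset.sum_congr rfl fun i _ => by rw [h1 i, mul_smul], ← Finset.smul_sum, ← smul_add]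
    congr 1; abel
  rw [← covInv_covOp hρ t z (ρ⁻¹ • _), map_smul, key, smul_smul, inv_mul_cancel₀ hρ.ne', one_smul]

/-- The bridge between the matrix formula used by the algorithm and the leverage that governs the
self-normalized process and the confidence width. -/
lemma posteriorVar_eq {ρ : ℝ} (hρ : 0 < ρ) (t : ℕ) (z : ℕ → Z) (a : Z) :
    posteriorVar (scalarKernel H) ρ t z a =
      ρ * inner ℝ (feature H a) (covInv H ρ t z (feature H a)) := by
  rw [covInv_feature hρ, inner_smul_right, mul_inv_cancel_left₀ hρ.ne', inner_sub_right,
    ← scalarKernel_eq_inner, inner_sum, posteriorVar]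
  congr 1
  simp only [dotProduct, inner_smul_right, ← scalarKernel_eq_inner, posteriorCoef]
  exact Finset.sum_congr rfl fun i _ => by rw [scalarKernel_comm, mul_comm]

lemma posteriorVar_nonneg {ρ : ℝ} (hρ : 0 < ρ) (t : ℕ) (z : ℕ → Z) (a : Z) :
    0 ≤ posteriorVar (scalarKernel H) ρ t z a := by
  rw [posteriorVar_eq hρ]
  exact mul_nonneg hρ.le (inner_covInv_self_nonneg hρ t z _)

lemma posteriorVar_le {ρ : ℝ} (hρ : 0 < ρ) (t : ℕ) (z : ℕ → Z) (a : Z) :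
    posteriorVar (scalarKernel H) ρ t z a ≤ scalarKernel H a a := by
  have := inner_covInv_self_le hρ t z (feature H a)
  rw [le_div_iff₀ hρ] at this
  rw [posteriorVar_eq hρ, scalarKernel_self]
  linarith

lemma posteriorStd_sq {ρ : ℝ} (hρ : 0 < ρ) (t : ℕ) (z : ℕ → Z) (a : Z) :
    posteriorStd (scalarKernel H) ρ t z a ^ 2 = posteriorVar (scalarKernel H) ρ t z a :=
  Real.sq_sqrt (posteriorVar_nonneg hρ t z a)

end Operator

/-! ## Information gain -/

section InfoGain

variable {Z H : Type*} [NormedAddCommGroup H] [InnerProductSpace ℝ H] [CompleteSpace H]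
  [RKHS ℝ H Z ℝ]

lemma one_add_smul_kernelMatrix {k : Z → Z → ℝ} {ρ : ℝ} (hρ : 0 < ρ) {t : ℕ} (z : Fin t → Z) :
    (1 : Matrix (Fin t) (Fin t) ℝ) + ρ⁻¹ • kernelMatrix k z =
      ρ⁻¹ • (kernelMatrix k z + ρ • (1 : Matrix (Fin t) (Fin t) ℝ)) := by
  rw [smul_add, smul_smul, inv_mul_cancel₀ hρ.ne', one_smul, add_comm]

lemma posDef_one_add_kernelMatrix {ρ : ℝ} (hρ : 0 < ρ) {t : ℕ} (z : Fin t → Z) :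
    ((1 : Matrix (Fin t) (Fin t) ℝ) + ρ⁻¹ • kernelMatrix (scalarKernel H) z).PosDef := by
  rw [one_add_smul_kernelMatrix hρ]
  exact (posDef_kernelMatrix_add hρ z).smul (inv_pos.mpr hρ)

/-- Chain rule for the determinant. -/
lemma det_one_add_kernelMatrix_succ {ρ : ℝ} (hρ : 0 < ρ) (t : ℕ) (z : ℕ → Z) :
    ((1 : Matrix (Fin (t + 1)) (Fin (t + 1)) ℝ)
        + ρ⁻¹ • kernelMatrix (scalarKernel H) fun i : Fin (t + 1) => z i).det =
      ((1 : Matrix (Fin t) (Fin t) ℝ) + ρ⁻¹ • kernelMatrix (scalarKernel H) fun i : Fin t => z i).det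
        * (1 + ρ⁻¹ * posteriorVar (scalarKernel H) ρ t z (z t)) := by
  set k := scalarKernel H
  set K := kernelMatrix k fun i : Fin t => z i with hK
  set A := (1 : Matrix (Fin t) (Fin t) ℝ) + ρ⁻¹ • K with hA
  let b : Matrix (Fin t) (Fin 1) ℝ := Matrix.of fun i _ => ρ⁻¹ * k (z i) (z t)
  let c : Matrix (Fin 1) (Fin t) ℝ := Matrix.of fun _ i => ρ⁻¹ * k (z i) (z t)
  let d : Matrix (Fin 1) (Fin 1) ℝ := Matrix.of fun _ _ => 1 + ρ⁻¹ * k (z t) (z t)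
  -- Split off the last point; its Schur complement is the scalar 1 + ρ⁻¹ times the posterior
  -- variance.
  have hblocks : ((1 : Matrix (Fin (t + 1)) (Fin (t + 1)) ℝ)
        + ρ⁻¹ • kernelMatrix k fun i : Fin (t + 1) => z i).submatrix finSumFinEquiv finSumFinEquiv =
      Matrix.fromBlocks A b c d := by
    ext i j
    rcases i with i | i <;> rcases j with j | j
    · simp [hA, hK, kernelMatrix, Matrix.one_apply, Fin.ext_iff]
    · have : (i : ℕ) ≠ t := i.2.ne
      simp [b, kernelMatrix, Fin.ext_iff, this]
    · have : t ≠ (j : ℕ) := j.2.ne'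
      simp [c, kernelMatrix, Fin.ext_iff, this, k, scalarKernel_comm (z t)]
    · have hi : i = 0 := Subsingleton.elim _ _
      have hj : j = 0 := Subsingleton.elim _ _
      simp [d, kernelMatrix, hi, hj]
  have hunit : IsUnit A.det :=
    (posDef_one_add_kernelMatrix (H := H) hρ fun i : Fin t => z i).det_pos.ne'.isUnit
  have hunit' := (posDef_kernelMatrix_add (H := H) hρ fun i : Fin t => z i).det_pos.ne'.isUnit
  let := Matrix.invertibleOfIsUnitDet A hunit
  have hAinv : A⁻¹ = ρ • (K + ρ • (1 : Matrix (Fin t) (Fin t) ℝ))⁻¹ := by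
    refine Matrix.inv_eq_right_inv ?_
    rw [hA, one_add_smul_kernelMatrix hρ, Matrix.smul_mul, Matrix.mul_smul, smul_smul,
      inv_mul_cancel₀ hρ.ne', one_smul]
    exact Matrix.mul_nonsing_inv _ hunit'
  rw [← Matrix.det_submatrix_equiv_self finSumFinEquiv, hblocks, Matrix.det_fromBlocks₁₁,
    Matrix.det_fin_one, Matrix.invOf_eq_nonsing_inv, hAinv]
  congr 1
  have hquad : (c * (ρ • (K + ρ • (1 : Matrix (Fin t) (Fin t) ℝ))⁻¹) * b) 0 0 =
      ρ⁻¹ * ((fun i : Fin t => k (z i) (z t)) ⬝ᵥ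
        ((K + ρ • (1 : Matrix (Fin t) (Fin t) ℝ))⁻¹).mulVec (fun i : Fin t => k (z i) (z t))) := by
    rw [Matrix.mul_assoc, Matrix.smul_mul, Matrix.mul_smul]
    have : b = ρ⁻¹ • Matrix.of fun (i : Fin t) _ => k (z i) (z t) := by ext; simp [b]
    rw [this, Matrix.mul_smul, Matrix.mul_smul, smul_smul, mul_inv_cancel₀ hρ.ne', one_smul]
    simp only [Matrix.mul_apply, c, Matrix.of_apply, dotProduct, Matrix.mulVec, Finset.mul_sum,
      mul_assoc]
  rw [Matrix.sub_apply, hquad, posteriorVar]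
  simp only [d, Matrix.of_apply]
  ring

lemma log_det_eq_sum {ρ : ℝ} (hρ : 0 < ρ) (t : ℕ) (z : ℕ → Z) :
    Real.log ((1 : Matrix (Fin t) (Fin t) ℝ)
        + ρ⁻¹ • kernelMatrix (scalarKernel H) fun i : Fin t => z i).det =
      ∑ n ∈ Finset.range t, Real.log (1 + ρ⁻¹ * posteriorVar (scalarKernel H) ρ n z (z n)) := by
  induction t with
  | zero => simp
  | succ t ih =>
    have h : 0 ≤ ρ⁻¹ * posteriorVar (scalarKernel H) ρ t z (z t) :=
      mul_nonneg (inv_nonneg.mpr hρ.le) (posteriorVar_nonneg hρ t z _)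
    rw [det_one_add_kernelMatrix_succ hρ, Real.log_mul
      (posDef_one_add_kernelMatrix hρ _).det_pos.ne' (by positivity), ih, Finset.sum_range_succ]

/-- The gain ranges over tuples while posterior variances take infinite sequences; the values beyond
t play no role. -/
lemma exists_seq_extending [Nonempty Z] {t : ℕ} (z : Fin t → Z) :
    ∃ z' : ℕ → Z, (fun i : Fin t => z' i) = z :=
  ⟨fun n => if h : n < t then z ⟨n, h⟩ else Classical.arbitrary Z, by ext i; simp⟩

/-- By the chain rule each of the t terms is at most log(1 + M/ρ). Without boundedness the real
supremum would be the default 0 and would bound nothing. -/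
lemma bddAbove_infoGain [Nonempty Z] {ρ M : ℝ} (hρ : 0 < ρ) (hM : ∀ a : Z, scalarKernel H a a ≤ M)
    (t : ℕ) : BddAbove (Set.range fun z : Fin t → Z => (1 / 2 : ℝ) * Real.log
      ((1 : Matrix (Fin t) (Fin t) ℝ) + ρ⁻¹ • kernelMatrix (scalarKernel H) z).det) := by
  refine ⟨1 / 2 * (t * Real.log (1 + ρ⁻¹ * M)), ?_⟩
  rintro _ ⟨z, rfl⟩
  obtain ⟨z, rfl⟩ := exists_seq_extending z
  simp only
  rw [log_det_eq_sum hρ]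
  gcongr
  calc _ ≤ ∑ n ∈ Finset.range t, Real.log (1 + ρ⁻¹ * M) := by
        refine Finset.sum_le_sum fun n _ => Real.log_le_log ?_ ?_
        · have := mul_nonneg (inv_nonneg.mpr hρ.le) (posteriorVar_nonneg (H := H) hρ n z (z n))
          positivity
        · gcongr
          exact (posteriorVar_le hρ n z _).trans (hM _)
    _ = _ := by simp

lemma sum_log_le_infoGain [Nonempty Z] {ρ M : ℝ} (hρ : 0 < ρ)
    (hM : ∀ a : Z, scalarKernel H a a ≤ M) (t : ℕ) (z : ℕ → Z) :
    ∑ n ∈ Finset.range t, Real.log (1 + ρ⁻¹ * posteriorVar (scalarKernel H) ρ n z (z n)) ≤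
      2 * infoGain (scalarKernel H) ρ t := by
  rw [← log_det_eq_sum hρ]
  have := le_ciSup (bddAbove_infoGain hρ hM t) fun i : Fin t => z i
  rw [infoGain]
  linarith

lemma infoGain_zero [Nonempty Z] (k : Z → Z → ℝ) (ρ : ℝ) : infoGain k ρ 0 = 0 := by
  simp [infoGain]

lemma infoGain_mono [Nonempty Z] {ρ M : ℝ} (hρ : 0 < ρ) (hM : ∀ a : Z, scalarKernel H a a ≤ M) :
    Monotone (infoGain (scalarKernel H) ρ) := by
  refine monotone_nat_of_le_succ fun t => ciSup_le fun z => ?_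
  obtain ⟨z, rfl⟩ := exists_seq_extending z
  have h := sum_log_le_infoGain hρ hM (t + 1) z
  have h0 : 0 ≤ Real.log (1 + ρ⁻¹ * posteriorVar (scalarKernel H) ρ t z (z t)) :=
    Real.log_nonneg (by
      have := mul_nonneg (inv_nonneg.mpr hρ.le) (posteriorVar_nonneg (H := H) hρ t z (z t))
      linarith)
  rw [log_det_eq_sum hρ]
  rw [Finset.sum_range_succ] at h
  linarith

lemma infoGain_nonneg [Nonempty Z] {ρ M : ℝ} (hρ : 0 < ρ) (hM : ∀ a : Z, scalarKernel H a a ≤ M)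
    (t : ℕ) : 0 ≤ infoGain (scalarKernel H) ρ t := by
  rw [← infoGain_zero (scalarKernel H) ρ]
  exact infoGain_mono hρ hM (Nat.zero_le t)

/-- Lower bound on the information gain, from repeating one point. -/
lemma log_one_add_mul_le_infoGain [Nonempty Z] {ρ M : ℝ} (hρ : 0 < ρ)
    (hM : ∀ a : Z, scalarKernel H a a ≤ M) (t : ℕ) (a : Z) :
    Real.log (1 + ρ⁻¹ * (t * scalarKernel H a a)) ≤ 2 * infoGain (scalarKernel H) ρ t := by
  have h := le_ciSup (bddAbove_infoGain hρ hM t) fun _ : Fin t => a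
  rw [← infoGain] at h
  have hdet : ((1 : Matrix (Fin t) (Fin t) ℝ)
      + ρ⁻¹ • kernelMatrix (scalarKernel H) fun _ : Fin t => a).det =
      1 + ρ⁻¹ * (t * scalarKernel H a a) := by
    -- With all points equal the kernel matrix has rank one.
    have : ρ⁻¹ • kernelMatrix (scalarKernel H) (fun _ : Fin t => a) =
        Matrix.replicateCol Unit (fun _ : Fin t => (1 : ℝ)) *
        Matrix.replicateRow Unit (fun _ : Fin t => ρ⁻¹ * scalarKernel H a a) := by
      ext i j; simp [kernelMatrix, Matrix.mul_apply]
    rw [this, Matrix.det_one_add_replicateCol_mul_replicateRow]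
    simp [dotProduct]; ring
  simp only [hdet] at h
  linarith

/-- If the information gain is small, then so is the kernel. -/
lemma scalarKernel_self_le_of_infoGain_le_one [Nonempty Z] {ρ M : ℝ} (hρ : 0 < ρ)
    (hM : ∀ a : Z, scalarKernel H a a ≤ M) {t : ℕ} (h1 : infoGain (scalarKernel H) ρ t ≤ 1)
    (a : Z) :
    t * scalarKernel H a a ≤ 2 * Real.exp 2 * ρ * infoGain (scalarKernel H) ρ t := by
  have h := log_one_add_mul_le_infoGain hρ hM t a
  set y := ρ⁻¹ * (t * scalarKernel H a a) with hy
  have hy0 : 0 ≤ y := by have := scalarKernel_self_nonneg (H := H) a; positivity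
  -- Since log(1 + y) ≤ 2γ ≤ 2, the denominator 1 + y is at most e², which makes the logarithmic
  -- bound on y linear in γ.
  have hlog : y / (1 + y) ≤ Real.log (1 + y) := by
    have := Real.one_sub_inv_le_log_of_pos (show 0 < 1 + y by positivity)
    refine le_trans (le_of_eq ?_) this
    field_simp; ring
  have hexp : 1 + y ≤ Real.exp 2 := by
    rw [← Real.log_le_iff_le_exp (by positivity)]; linarith
  have : y ≤ Real.exp 2 * (2 * infoGain (scalarKernel H) ρ t) := by
    rw [div_le_iff₀ (by positivity)] at hlog
    have hl0 : 0 ≤ Real.log (1 + y) := Real.log_nonneg (by linarith)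
    nlinarith
  have hyρ : t * scalarKernel H a a = ρ * y := by rw [hy, mul_inv_cancel_left₀ hρ.ne']
  rw [hyρ]
  nlinarith

end InfoGain

/-! ## Exponential inequalities for a binary outcome -/

section Binary

/-- Hoeffding's lemma for a Bernoulli variable. -/
lemma bernoulli_mgf_le {q : ℝ} (hq0 : 0 ≤ q) (hq1 : q ≤ 1) (a : ℝ) :
    (1 - q) * Real.exp (a * (0 - q)) + q * Real.exp (a * (1 - q)) ≤ Real.exp (a ^ 2 / 8) := by
  let μ : Measure ℝ := ENNReal.ofReal (1 - q) • Measure.dirac 0 + ENNReal.ofReal q • Measure.dirac 1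
  have hint : ∀ g : ℝ → ℝ, ∫ x, g x ∂μ = (1 - q) * g 0 + q * g 1 := fun g => by
    rw [integral_add_measure, integral_smul_measure, integral_smul_measure, integral_dirac,
      integral_dirac, ENNReal.toReal_ofReal hq0, ENNReal.toReal_ofReal (by linarith), smul_eq_mul,
      smul_eq_mul]
    · exact (integrable_dirac (by finiteness)).smul_measure ENNReal.ofReal_ne_top
    · exact (integrable_dirac (by finiteness)).smul_measure ENNReal.ofReal_ne_top
  have : IsProbabilityMeasure μ := ⟨by
    simp only [μ, Measure.add_apply, Measure.smul_apply, measure_univ, smul_eq_mul, mul_one]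
    rw [← ENNReal.ofReal_add (by linarith) hq0]
    simp⟩
  have hb : ∀ᵐ x ∂μ, x ∈ Set.Icc (0 : ℝ) 1 := by
    rw [ae_iff]
    simp [μ]
  have h := (hasSubgaussianMGF_of_mem_Icc (μ := μ) (X := id) aemeasurable_id hb).mgf_le a
  rw [mgf, hint, hint] at h
  simp only [id_eq, mul_zero, mul_one, zero_add, sub_zero, nnnorm_one] at h
  refine h.trans (le_of_eq ?_)
  congr 1
  push_cast
  ring

lemma integral_exp_neg_mul_sub_sq (b c : ℝ) :
    ∫ x : ℝ, Real.exp (-b * (x - c) ^ 2) = √(Real.pi / b) := by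
  rw [integral_sub_right_eq_self (fun x => Real.exp (-b * x ^ 2)) c, integral_gaussian]

lemma integrable_exp_neg_mul_sub_sq {b : ℝ} (hb : 0 < b) (c : ℝ) :
    Integrable fun x : ℝ => Real.exp (-b * (x - c) ^ 2) :=
  (integrable_exp_neg_mul_sq hb).comp_sub_right c

/-- The increment of the exponent of the self-normalized process of a binary outcome with noise
`e`, at a point with inner product `m` and leverage `w`. -/
noncomputable def selfNormIncr (w m e : ℝ) : ℝ :=
  2 * (2 * e * m + e ^ 2 * w - m ^ 2) / (1 + w)

/-- For fixed x, Hoeffding gives exp(4xe - 2x²) mean at most 1 over the noise e. Averaging over x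
from a Gaussian with mean m and variance w/4 and completing the square produces `selfNormIncr`; the
ratio of the Gaussian normalizations is √(1 + w). For w = 0 the Gaussian degenerates to the point x
= m. -/
lemma bernoulli_selfNorm_le {q w : ℝ} (hq0 : 0 ≤ q) (hq1 : q ≤ 1) (hw : 0 ≤ w) (m : ℝ) :
    (1 - q) * Real.exp (selfNormIncr w m (0 - q)) + q * Real.exp (selfNormIncr w m (1 - q)) ≤
      √(1 + w) := by
  rcases hw.eq_or_lt with rfl | hw
  · have h := bernoulli_mgf_le hq0 hq1 (4 * m)
    have hs : ∀ e : ℝ, Real.exp (selfNormIncr 0 m e) =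
        Real.exp (4 * m * e) * Real.exp (-(2 * m ^ 2)) := fun e => by
      rw [← Real.exp_add, selfNormIncr]; congr 1; ring
    rw [hs, hs, add_zero, Real.sqrt_one, ← mul_assoc, ← mul_assoc, ← add_mul]
    calc _ ≤ Real.exp ((4 * m) ^ 2 / 8) * Real.exp (-(2 * m ^ 2)) := by gcongr
      _ = 1 := by rw [← Real.exp_add, Real.exp_eq_one_iff]; ring
  · set b := 2 * (1 + w) / w with hb
    have hb0 : 0 < b := by positivity
    have hcomplete : ∀ e x : ℝ, Real.exp (-(2 / w) * (x - m) ^ 2) *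
        (Real.exp (4 * x * e) * Real.exp (-(2 * x ^ 2))) =
        Real.exp (selfNormIncr w m e) * Real.exp (-b * (x - (m + e * w) / (1 + w)) ^ 2) := by
      intro e x
      rw [← Real.exp_add, ← Real.exp_add, ← Real.exp_add, selfNormIncr, hb]
      congr 1
      field_simp
      ring
    have hle : ∀ x : ℝ,
        (1 - q) * (Real.exp (selfNormIncr w m (0 - q)) *
          Real.exp (-b * (x - (m + (0 - q) * w) / (1 + w)) ^ 2)) +
        q * (Real.exp (selfNormIncr w m (1 - q)) *
          Real.exp (-b * (x - (m + (1 - q) * w) / (1 + w)) ^ 2)) ≤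
        Real.exp (-(2 / w) * (x - m) ^ 2) := by
      intro x
      rw [← hcomplete, ← hcomplete]
      have h := bernoulli_mgf_le hq0 hq1 (4 * x)
      calc _ = Real.exp (-(2 / w) * (x - m) ^ 2) * (((1 - q) * Real.exp (4 * x * (0 - q))
            + q * Real.exp (4 * x * (1 - q))) * Real.exp (-(2 * x ^ 2))) := by ring
        _ ≤ Real.exp (-(2 / w) * (x - m) ^ 2) *
            (Real.exp ((4 * x) ^ 2 / 8) * Real.exp (-(2 * x ^ 2))) := by gcongr
        _ = _ := by
          rw [← Real.exp_add]
          have : (4 * x) ^ 2 / 8 + -(2 * x ^ 2) = 0 := by ring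
          rw [this, Real.exp_zero, mul_one]
    have hi := fun c => integrable_exp_neg_mul_sub_sq hb0 c
    have h := integral_mono ((((hi _).const_mul _).const_mul _).add
      (((hi _).const_mul _).const_mul _)) (integrable_exp_neg_mul_sub_sq (by positivity) m) hle
    simp only [Pi.add_apply] at h
    rw [integral_add (((hi _).const_mul _).const_mul _) (((hi _).const_mul _).const_mul _)] at h
    simp only [integral_const_mul, integral_exp_neg_mul_sub_sq] at h
    have hsq : √(Real.pi / (2 / w)) = √(1 + w) * √(Real.pi / b) := by
      rw [← Real.sqrt_mul (by positivity), hb]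
      congr 1
      field_simp
    have hpos : 0 < √(Real.pi / b) := Real.sqrt_pos.mpr (div_pos Real.pi_pos hb0)
    rw [hsq] at h
    refine le_of_mul_le_mul_right (le_trans (le_of_eq ?_) h) hpos
    ring

/-- A lower-tail exponential inequality for a Bernoulli variable. -/
lemma bernoulli_exp_lower_le {p v : ℝ} (hp0 : 0 ≤ p) (hv0 : 0 ≤ v) (hv1 : v ≤ 1) :
    (1 - p) * Real.exp (p * v / 2) + p * Real.exp (p * v / 2 - v) ≤ 1 := by
  -- Chord of the convex exponential over [-1, 0], with e⁻¹ ≤ 1/2.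
  have h1 : Real.exp (-v) ≤ 1 - v / 2 := by
    have h := convexOn_exp.2 (Set.mem_univ (-1)) (Set.mem_univ 0) hv0 (sub_nonneg.mpr hv1)
      (by ring)
    simp only [smul_eq_mul, mul_neg, mul_one, mul_zero, add_zero, Real.exp_zero] at h
    have : Real.exp (-1) ≤ 1 / 2 := by
      rw [Real.exp_neg, inv_le_comm₀ (Real.exp_pos 1) (by norm_num)]
      have := Real.add_one_le_exp 1
      norm_num at this ⊢
      linarith
    nlinarith
  have h2 : 1 - p * v / 2 ≤ Real.exp (-(p * v / 2)) := by
    have := Real.add_one_le_exp (-(p * v / 2)); linarith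
  calc _ = Real.exp (p * v / 2) * (1 - p + p * Real.exp (-v)) := by
        rw [sub_eq_add_neg (p * v / 2), Real.exp_add]; ring
    _ ≤ Real.exp (p * v / 2) * Real.exp (-(p * v / 2)) := by
        gcongr
        nlinarith
    _ = 1 := by rw [← Real.exp_add, add_neg_cancel, Real.exp_zero]

/-- An upper-tail exponential inequality for a Bernoulli variable. -/
lemma bernoulli_exp_upper_le {p v : ℝ} (hp0 : 0 ≤ p) (hv0 : 0 ≤ v) (hv1 : v ≤ 1) :
    (1 - p) * Real.exp (-(2 * p * v)) + p * Real.exp (v - 2 * p * v) ≤ 1 := by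
  -- Chord over [0, 1], with e ≤ 3.
  have h1 : Real.exp v ≤ 1 + 2 * v := by
    have h := convexOn_exp.2 (Set.mem_univ 1) (Set.mem_univ 0) hv0 (sub_nonneg.mpr hv1) (by ring)
    simp only [smul_eq_mul, mul_one, mul_zero, add_zero, Real.exp_zero] at h
    have := Real.exp_one_lt_d9
    nlinarith
  have h2 : 1 + 2 * p * v ≤ Real.exp (2 * p * v) := by
    have := Real.add_one_le_exp (2 * p * v); linarith
  calc _ = Real.exp (-(2 * p * v)) * (1 - p + p * Real.exp v) := by
        rw [sub_eq_add_neg v, Real.exp_add]; ring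
    _ ≤ Real.exp (-(2 * p * v)) * Real.exp (2 * p * v) := by
        gcongr
        nlinarith
    _ = 1 := by rw [← Real.exp_add, neg_add_cancel, Real.exp_zero]

end Binary

/-! ## Exponential supermartingales -/

section Probability

variable {Ω : Type*} {mΩ : MeasurableSpace Ω} {μ : Measure Ω}

/-- Integrating a measurable function against a variable or its conditional expectation. -/
lemma lintegral_ofReal_mul_eq_of_condExp [IsFiniteMeasure μ] {m : MeasurableSpace Ω} (hm : m ≤ mΩ)
    {X q : Ω → ℝ} (hX : Integrable X μ) (hX0 : 0 ≤ X) (hq : μ[X | m] =ᵐ[μ] q)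
    {g : Ω → ENNReal} (hg : Measurable[m] g) :
    ∫⁻ ω, ENNReal.ofReal (X ω) * g ω ∂μ = ∫⁻ ω, ENNReal.ofReal (q ω) * g ω ∂μ := by
  have hqi : Integrable q μ := integrable_condExp.congr hq
  have hq0 : 0 ≤ᵐ[μ] q := by
    filter_upwards [hq, condExp_nonneg (m := m) (ae_of_all μ hX0)] with ω h1 h2
    rwa [← h1]
  have hXm : AEMeasurable (fun ω => ENNReal.ofReal (X ω)) μ := hX.aemeasurable.ennreal_ofReal
  have hqm : AEMeasurable (fun ω => ENNReal.ofReal (q ω)) μ := hqi.aemeasurable.ennreal_ofReal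
  -- The two densities give the same measure on m, and an m-measurable integrand sees only that
  -- restriction.
  have htrim : (μ.withDensity fun ω => ENNReal.ofReal (X ω)).trim hm =
      (μ.withDensity fun ω => ENNReal.ofReal (q ω)).trim hm := by
    refine @Measure.ext _ m _ _ fun s hs => ?_
    rw [trim_measurableSet_eq hm hs, trim_measurableSet_eq hm hs, withDensity_apply _ (hm s hs),
      withDensity_apply _ (hm s hs),
      ← ofReal_integral_eq_lintegral_ofReal hX.integrableOn (ae_of_all _ hX0),
      ← ofReal_integral_eq_lintegral_ofReal hqi.integrableOn (ae_restrict_of_ae hq0),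
      ← setIntegral_condExp hm hX hs]
    congr 1
    exact setIntegral_congr_ae (hm s hs) (hq.mono fun ω h _ => h)
  have h1 := lintegral_withDensity_eq_lintegral_mul₀ hXm (hg.mono hm le_rfl).aemeasurable
  have h2 := lintegral_withDensity_eq_lintegral_mul₀ hqm (hg.mono hm le_rfl).aemeasurable
  rw [← lintegral_trim hm hg, htrim, lintegral_trim hm hg] at h1
  exact h1.symm.trans h2

/-- The exponential of `D` has conditional mean at most `1` given `m`. -/
def IsExpIncrement (μ : Measure Ω) (m : MeasurableSpace Ω) (D : Ω → ℝ) : Prop :=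
  ∀ W : Ω → ENNReal, Measurable[m] W →
    ∫⁻ ω, W ω * ENNReal.ofReal (Real.exp (D ω)) ∂μ ≤ ∫⁻ ω, W ω ∂μ

lemma IsExpIncrement.mono {m m' : MeasurableSpace Ω} {D : Ω → ℝ} (h : IsExpIncrement μ m' D)
    (hm : m ≤ m') : IsExpIncrement μ m D :=
  fun W hW => h W (hW.mono hm le_rfl)

lemma boolReal_nonneg (c : Bool) : 0 ≤ boolReal c := by cases c <;> simp [boolReal]

lemma boolReal_le_one (c : Bool) : boolReal c ≤ 1 := by cases c <;> simp [boolReal]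

lemma measurable_boolReal : Measurable boolReal := measurable_of_finite _

/-- An exponential increment driven by a binary variable `Y` with conditional mean `q`. -/
lemma isExpIncrement_of_binary [IsProbabilityMeasure μ] {m : MeasurableSpace Ω} (hm : m ≤ mΩ)
    {Y : Ω → Bool} (hY : Measurable[mΩ] Y) {q : Ω → ℝ} (hq : μ[fun ω => boolReal (Y ω) | m] =ᵐ[μ] q)
    {D : Bool → Ω → ℝ} (hD : ∀ c, Measurable[m] (D c))
    (hle : ∀ᵐ ω ∂μ, 0 ≤ q ω → q ω ≤ 1 →
      (1 - q ω) * Real.exp (D false ω) + q ω * Real.exp (D true ω) ≤ 1) :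
    IsExpIncrement μ m fun ω => D (Y ω) ω := by
  intro W hW
  have hYm : Measurable[mΩ] fun ω => boolReal (Y ω) := measurable_boolReal.comp hY
  have hYi : Integrable (fun ω => boolReal (Y ω)) μ :=
    Integrable.of_mem_Icc 0 1 hYm.aemeasurable
      (ae_of_all _ fun ω => ⟨boolReal_nonneg _, boolReal_le_one _⟩)
  have hYi' : Integrable (fun ω => 1 - boolReal (Y ω)) μ := (integrable_const 1).sub hYi
  have hq' : μ[fun ω => 1 - boolReal (Y ω) | m] =ᵐ[μ] fun ω => 1 - q ω := by
    have h := condExp_sub (integrable_const (1 : ℝ)) hYi m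
    rw [condExp_const hm] at h
    filter_upwards [h, hq] with ω h1 h2
    rw [← h2]; exact h1
  have hW' : ∀ c, Measurable[m] fun ω => W ω * ENNReal.ofReal (Real.exp (D c ω)) := fun c =>
    hW.mul (Real.measurable_exp.comp (hD c)).ennreal_ofReal
  have hq0 : ∀ᵐ ω ∂μ, 0 ≤ q ω := by
    filter_upwards [hq, condExp_nonneg (m := m) (ae_of_all μ fun ω => boolReal_nonneg (Y ω))]
      with ω h1 h2
    rw [← h1]; exact h2
  have hq1 : ∀ᵐ ω ∂μ, q ω ≤ 1 := by
    filter_upwards [hq', condExp_nonneg (m := m) (f := fun ω => 1 - boolReal (Y ω))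
      (ae_of_all μ fun ω => sub_nonneg.mpr (boolReal_le_one (Y ω)))] with ω h1 h2
    have : (0 : ℝ) ≤ 1 - q ω := by rw [← h1]; exact h2
    linarith
  -- Splitting by the value of Y leaves m-measurable factors against Y and 1 - Y, which may then be
  -- replaced by q and 1 - q.
  calc ∫⁻ ω, W ω * ENNReal.ofReal (Real.exp (D (Y ω) ω)) ∂μ
      = ∫⁻ ω, (ENNReal.ofReal (1 - boolReal (Y ω)) *
            (W ω * ENNReal.ofReal (Real.exp (D false ω)))
          + ENNReal.ofReal (boolReal (Y ω)) *
            (W ω * ENNReal.ofReal (Real.exp (D true ω)))) ∂μ := by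
        refine lintegral_congr fun ω => ?_
        cases Y ω <;> simp [boolReal]
    _ = ∫⁻ ω, (ENNReal.ofReal (1 - q ω) * (W ω * ENNReal.ofReal (Real.exp (D false ω)))
          + ENNReal.ofReal (q ω) * (W ω * ENNReal.ofReal (Real.exp (D true ω)))) ∂μ := by
        have hqm : AEMeasurable (fun ω => ENNReal.ofReal (1 - q ω)) μ :=
          (integrable_condExp.congr hq').aemeasurable.ennreal_ofReal
        rw [lintegral_add_left, lintegral_add_left',
          lintegral_ofReal_mul_eq_of_condExp hm hYi' (fun ω => sub_nonneg.mpr (boolReal_le_one _))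
            hq' (hW' false),
          lintegral_ofReal_mul_eq_of_condExp hm hYi (fun ω => boolReal_nonneg _) hq (hW' true)]
        · exact hqm.mul ((hW' false).mono hm le_rfl).aemeasurable
        · exact ((measurable_const.sub hYm).ennreal_ofReal).mul ((hW' false).mono hm le_rfl)
    _ ≤ ∫⁻ ω, W ω ∂μ := by
        refine lintegral_mono_ae ?_
        filter_upwards [hle, hq0, hq1] with ω h h0 h1
        calc _ = W ω * ENNReal.ofReal
              ((1 - q ω) * Real.exp (D false ω) + q ω * Real.exp (D true ω)) := by
              have := Real.exp_pos (D false ω)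
              have := Real.exp_pos (D true ω)
              rw [ENNReal.ofReal_add (mul_nonneg (by linarith) (by positivity)) (by positivity),
                ENNReal.ofReal_mul (by linarith), ENNReal.ofReal_mul h0]
              ring
          _ ≤ W ω * 1 := by gcongr; exact ENNReal.ofReal_le_one.mpr (h h0 h1)
          _ = W ω := mul_one _

/-- Ville's maximal inequality. -/
lemma mul_measure_exists_ge_le (𝒢 : Filtration ℕ mΩ) {M : ℕ → Ω → ENNReal}
    (hM : ∀ n, Measurable[𝒢 n] (M n))
    (hsup : ∀ n s, MeasurableSet[𝒢 n] s → ∫⁻ ω in s, M (n + 1) ω ∂μ ≤ ∫⁻ ω in s, M n ω ∂μ)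
    (c : ENNReal) : c * μ {ω | ∃ n, c ≤ M n ω} ≤ ∫⁻ ω, M 0 ω ∂μ := by
  -- The strict inequality makes A (n + 1) measurable for `𝒢 n`, so the supermartingale step can be
  -- applied on its complement.
  let A : ℕ → Set Ω := fun n => {ω | ∃ k < n, c ≤ M k ω}
  have hA : ∀ n, MeasurableSet[𝒢 n] (A (n + 1)) := by
    intro n
    have : A (n + 1) = ⋃ k ∈ Finset.range (n + 1), {ω | c ≤ M k ω} := by ext; simp [A]
    rw [this]
    refine Finset.measurableSet_biUnion _ fun k hk =>
      𝒢.mono (by simpa [Nat.lt_succ_iff] using hk) _ ?_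
    exact hM k measurableSet_Ici
  have hA' : ∀ n, MeasurableSet (A n) := by
    rintro (_ | n)
    · simp [A]
    · exact 𝒢.le n _ (hA n)
  -- This is the stopped process in disguise: paths that have crossed are frozen at c, the others
  -- carry M n.
  have key : ∀ n, c * μ (A n) + ∫⁻ ω in (A n)ᶜ, M n ω ∂μ ≤ ∫⁻ ω, M 0 ω ∂μ := by
    intro n
    induction n with
    | zero => simp [A]
    | succ n ih =>
      refine le_trans ?_ ih
      have hmono : A n ⊆ A (n + 1) := fun ω ⟨k, hk, h⟩ => ⟨k, hk.trans (Nat.lt_succ_self n), h⟩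
      set E := A (n + 1) \ A n with hE
      have hEm : MeasurableSet E := (hA' _).diff (hA' _)
      have hEle : ∀ ω ∈ E, c ≤ M n ω := by
        rintro ω ⟨⟨k, hk, h⟩, h2⟩
        rcases Nat.lt_succ_iff_lt_or_eq.mp hk with hlt | rfl
        · exact absurd ⟨k, hlt, h⟩ h2
        · exact h
      have hμ : μ (A (n + 1)) = μ (A n) + μ E := by
        rw [← measure_union Set.disjoint_sdiff_right hEm, Set.union_sdiff_cancel hmono]
      have hcompl : (A n)ᶜ = (A (n + 1))ᶜ ∪ E := by
        ext ω
        by_cases h1 : ω ∈ A n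
        · simp [h1, hE, hmono h1]
        · by_cases h2 : ω ∈ A (n + 1) <;> simp [h1, h2, hE]
      have hdisj : Disjoint (A (n + 1))ᶜ E :=
        Set.disjoint_left.mpr fun ω h1 h2 => h1 h2.1
      rw [hμ, hcompl, lintegral_union hEm hdisj, mul_add]
      have h1 := hsup n _ (hA n).compl
      have h2 : c * μ E ≤ ∫⁻ ω in E, M n ω ∂μ := by
        rw [← setLIntegral_const]
        exact setLIntegral_mono' hEm hEle
      calc _ ≤ c * μ (A n) + ∫⁻ ω in E, M n ω ∂μ + ∫⁻ ω in (A (n + 1))ᶜ, M n ω ∂μ := by gcongr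
        _ = _ := by rw [add_assoc, add_comm (∫⁻ ω in E, M n ω ∂μ)]
  have hU : {ω | ∃ n, c ≤ M n ω} = ⋃ n, A n := by
    ext ω
    simp only [A, Set.mem_ofPred_eq, Set.mem_iUnion]
    exact ⟨fun ⟨n, h⟩ => ⟨n + 1, n, Nat.lt_succ_self n, h⟩, fun ⟨_, k, _, h⟩ => ⟨k, h⟩⟩
  have hmonoA : Monotone A := fun a b hab ω ⟨k, hk, h⟩ => ⟨k, hk.trans_le hab, h⟩
  rw [hU, hmonoA.measure_iUnion, ENNReal.mul_iSup]
  exact iSup_le fun n => le_self_add.trans (key n)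

/-- A time-uniform bound for a finite family of exponential supermartingales. -/
lemma measure_exists_sum_ge_le [IsProbabilityMeasure μ] (𝒢 : Filtration ℕ mΩ)
    {ι : Type*} [Fintype ι] [Nonempty ι] {D : ι → ℕ → Ω → ℝ}
    (hD : ∀ i n, Measurable[𝒢 (n + 1)] (D i n)) (hexp : ∀ i n, IsExpIncrement μ (𝒢 n) (D i n))
    {δ : ℝ} (hδ : 0 < δ) :
    μ {ω | ∃ n i, Real.log (Fintype.card ι / δ) ≤ ∑ k ∈ Finset.range n, D i k ω} ≤
      ENNReal.ofReal δ := by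
  let E : ι → ℕ → Ω → ENNReal := fun i n ω =>
    ENNReal.ofReal (Real.exp (∑ k ∈ Finset.range n, D i k ω))
  have hE : ∀ i n, Measurable[𝒢 n] (E i n) := fun i n =>
    (Real.measurable_exp.comp (Finset.measurable_sum _ fun k hk =>
      (hD i k).mono (𝒢.mono (Finset.mem_range.mp hk)) le_rfl)).ennreal_ofReal
  have hstep : ∀ i n s, MeasurableSet[𝒢 n] s →
      ∫⁻ ω in s, E i (n + 1) ω ∂μ ≤ ∫⁻ ω in s, E i n ω ∂μ := by
    intro i n s hs
    have h := hexp i n _ ((hE i n).indicator hs)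
    rw [lintegral_indicator (𝒢.le n s hs)] at h
    refine le_trans (le_of_eq ?_) h
    rw [← lintegral_indicator (𝒢.le n s hs)]
    refine lintegral_congr fun ω => ?_
    by_cases hω : ω ∈ s
    · simp only [hω, Set.indicator_of_mem, E, Finset.sum_range_succ, Real.exp_add]
      rw [ENNReal.ofReal_mul (Real.exp_pos _).le]
    · simp [hω]
  have hcard : (0 : ℝ) < Fintype.card ι := by exact_mod_cast Fintype.card_pos
  -- The sum of the processes is again a supermartingale and starts at the cardinality of ι, so one
  -- application of Ville replaces a union bound.
  have h := mul_measure_exists_ge_le (μ := μ) 𝒢 (M := fun n ω => ∑ i, E i n ω)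
    (fun n => Finset.measurable_sum _ fun i _ => hE i n)
    (fun n s hs => by
      rw [lintegral_finsetSum _ fun i _ => (hE i _).mono (𝒢.le _) le_rfl,
        lintegral_finsetSum _ fun i _ => (hE i _).mono (𝒢.le _) le_rfl]
      exact Finset.sum_le_sum fun i _ => hstep i n s hs)
    (ENNReal.ofReal (Fintype.card ι / δ))
  have h0 : ∫⁻ ω, ∑ i, E i 0 ω ∂μ = Fintype.card ι := by simp [E]
  rw [h0] at h
  have hsub : μ {ω | ∃ n i, Real.log (Fintype.card ι / δ) ≤ ∑ k ∈ Finset.range n, D i k ω} ≤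
      μ {ω | ∃ n, ENNReal.ofReal (Fintype.card ι / δ) ≤ ∑ i, E i n ω} := by
    refine measure_mono ?_
    rintro ω ⟨n, i, hi⟩
    refine ⟨n, le_trans ?_ (Finset.single_le_sum (f := fun i => E i n ω) (fun _ _ => zero_le)
      (Finset.mem_univ i))⟩
    refine ENNReal.ofReal_le_ofReal ?_
    rwa [← Real.log_le_iff_le_exp (by positivity)]
  refine hsub.trans ?_
  have hne : ENNReal.ofReal (Fintype.card ι / δ) ≠ 0 := by
    rw [Ne, ENNReal.ofReal_eq_zero, not_le]; positivity
  rw [← ENNReal.mul_le_mul_iff_right hne ENNReal.ofReal_ne_top]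
  refine h.trans (le_of_eq ?_)
  rw [← ENNReal.ofReal_mul (by positivity), div_mul_cancel₀ _ hδ.ne', ENNReal.ofReal_natCast]

end Probability

/-! ## The sigmoid -/

section Sigmoid

lemma sigmoidDeriv_pos (a : ℝ) : 0 < sigmoidDeriv a :=
  mul_pos (Real.sigmoid_pos a) (sub_pos.mpr (Real.sigmoid_lt_one a))

lemma continuous_sigmoidDeriv : Continuous sigmoidDeriv :=
  continuous_sigmoid.mul (continuous_const.sub continuous_sigmoid)

lemma sigmoidDeriv_le_sigmoidLip {R a : ℝ} (ha : a ∈ Set.Icc (-R) R) :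
    sigmoidDeriv a ≤ sigmoidLip R :=
  le_csSup (isCompact_Icc.image continuous_sigmoidDeriv).bddAbove (Set.mem_image_of_mem _ ha)

lemma inv_sigmoidDeriv_le_sigmoidKappa {R a : ℝ} (ha : a ∈ Set.Icc (-R) R) :
    1 / sigmoidDeriv a ≤ sigmoidKappa R :=
  le_csSup (isCompact_Icc.image (continuous_const.div continuous_sigmoidDeriv
    fun a => (sigmoidDeriv_pos a).ne')).bddAbove
    (Set.mem_image_of_mem (fun a => 1 / sigmoidDeriv a) ha)

lemma sigmoidLip_pos {R : ℝ} (hR : 0 ≤ R) : 0 < sigmoidLip R :=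
  (sigmoidDeriv_pos 0).trans_le (sigmoidDeriv_le_sigmoidLip ⟨by linarith, hR⟩)

lemma sigmoidKappa_pos {R : ℝ} (hR : 0 ≤ R) : 0 < sigmoidKappa R :=
  (one_div_pos.mpr (sigmoidDeriv_pos 0)).trans_le
    (inv_sigmoidDeriv_le_sigmoidKappa ⟨by linarith, hR⟩)

lemma inv_sigmoidKappa_le {R a : ℝ} (ha : a ∈ Set.Icc (-R) R) :
    (sigmoidKappa R)⁻¹ ≤ sigmoidDeriv a := by
  have h := inv_sigmoidDeriv_le_sigmoidKappa ha
  rw [one_div] at h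
  exact inv_le_of_inv_le₀ (sigmoidDeriv_pos a) h

lemma sigmoid_sub_le {R a b : ℝ} (ha : a ∈ Set.Icc (-R) R) (hb : b ∈ Set.Icc (-R) R)
    (hab : a ≤ b) : Real.sigmoid b - Real.sigmoid a ≤ sigmoidLip R * (b - a) :=
  (convex_Icc (-R) R).image_sub_le_mul_sub_of_deriv_le continuous_sigmoid.continuousOn
    differentiable_sigmoid.differentiableOn
    (fun c hc => by
      rw [Real.deriv_sigmoid]
      exact sigmoidDeriv_le_sigmoidLip (interior_subset hc)) a ha b hb hab

lemma le_sigmoid_sub {R a b : ℝ} (ha : a ∈ Set.Icc (-R) R) (hb : b ∈ Set.Icc (-R) R)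
    (hab : a ≤ b) : (sigmoidKappa R)⁻¹ * (b - a) ≤ Real.sigmoid b - Real.sigmoid a :=
  (convex_Icc (-R) R).mul_sub_le_image_sub_of_le_deriv continuous_sigmoid.continuousOn
    differentiable_sigmoid.differentiableOn
    (fun c hc => by
      rw [Real.deriv_sigmoid]
      exact inv_sigmoidKappa_le (interior_subset hc)) a ha b hb hab

/-- Strong monotonicity of the sigmoid on [-R, R]; this is how κ enters the confidence bound. -/
lemma sigmoid_sub_mul_sub_ge {R a b : ℝ} (ha : a ∈ Set.Icc (-R) R) (hb : b ∈ Set.Icc (-R) R) :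
    (sigmoidKappa R)⁻¹ * (a - b) ^ 2 ≤ (Real.sigmoid a - Real.sigmoid b) * (a - b) := by
  rcases le_total a b with h | h
  · nlinarith [le_sigmoid_sub ha hb h]
  · nlinarith [le_sigmoid_sub hb ha h]

end Sigmoid

/-! ## Confidence bounds for the projected logistic estimate -/

section Confidence

variable {Z H : Type*} [NormedAddCommGroup H] [InnerProductSpace ℝ H] [CompleteSpace H]
  [RKHS ℝ H Z ℝ]

lemma hasDerivAt_bernoulliLoss (y a : ℝ) :
    HasDerivAt (fun a => -y * Real.log (Real.sigmoid a) - (1 - y) * Real.log (1 - Real.sigmoid a))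
      (Real.sigmoid a - y) a := by
  have hs := Real.sigmoid_pos a
  have hs' := sub_pos.mpr (Real.sigmoid_lt_one a)
  have h := (((Real.hasDerivAt_sigmoid a).log hs.ne').const_mul (-y)).sub
    ((((Real.hasDerivAt_sigmoid a).const_sub 1).log hs'.ne').const_mul (1 - y))
  refine h.congr_deriv ?_
  field_simp
  ring

/-- The first-order condition for the regularized logistic estimate. -/
lemma gradMap_eq_of_isLogisticMinimizer {lam : ℝ} {t : ℕ} {z : ℕ → Z} {y : ℕ → ℝ} {θ : H}
    (hθ : IsLogisticMinimizer lam t z y θ) :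
    gradMap lam t z θ = ∑ τ ∈ Finset.range t, y τ • feature H (z τ) := by
  refine ext_inner_right ℝ fun v => ?_
  have hder : HasDerivAt (fun s : ℝ => logisticLoss lam t z y (θ + s • v))
      ((∑ τ ∈ Finset.range t, (Real.sigmoid (θ (z τ)) - y τ) * v (z τ)) + lam * inner ℝ θ v) 0 := by
    have hsum : HasDerivAt (fun s : ℝ => ∑ τ ∈ Finset.range t,
        (-(y τ) * Real.log (Real.sigmoid ((θ + s • v) (z τ)))
          - (1 - y τ) * Real.log (1 - Real.sigmoid ((θ + s • v) (z τ)))))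
        (∑ τ ∈ Finset.range t, (Real.sigmoid (θ (z τ)) - y τ) * v (z τ)) 0 := by
      refine HasDerivAt.fun_sum fun τ _ => ?_
      have h1 : HasDerivAt (fun s : ℝ => (θ + s • v) (z τ)) (v (z τ)) 0 := by
        simpa using ((hasDerivAt_id (0 : ℝ)).mul_const (v (z τ))).const_add (θ (z τ))
      have h2 := hasDerivAt_bernoulliLoss (y τ) ((θ + (0 : ℝ) • v) (z τ))
      have h3 := h2.comp (0 : ℝ) h1
      simpa [Function.comp_def] using h3
    have hnorm : HasDerivAt (fun s : ℝ => lam / 2 * ‖θ + s • v‖ ^ 2) (lam * inner ℝ θ v) 0 := by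
      have h1 : HasDerivAt (fun s : ℝ => θ + s • v) v 0 := by
        simpa using ((hasDerivAt_id (0 : ℝ)).smul_const v).const_add θ
      have h2 := (h1.norm_sq).const_mul (lam / 2)
      refine h2.congr_deriv ?_
      simp
      ring
    exact hsum.add hnorm
  have hmin : IsLocalMin (fun s : ℝ => logisticLoss lam t z y (θ + s • v)) 0 :=
    Filter.Eventually.of_forall fun s => by simpa using hθ (θ + s • v)
  have h0 := hmin.hasDerivAt_eq_zero hder
  rw [gradMap, inner_add_left, inner_smul_left, sum_inner, sum_inner]
  simp only [inner_smul_left, feature_inner, conj_trivial, sub_mul, Finset.sum_sub_distrib] at h0 ⊢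
  linarith

/-- The sum of the noise terms against the features. -/
noncomputable def noiseSum (F : H) (t : ℕ) (z : ℕ → Z) (y : ℕ → ℝ) : H :=
  ∑ τ ∈ Finset.range t, (y τ - Real.sigmoid (F (z τ))) • feature H (z τ)

lemma noiseSum_succ (F : H) (t : ℕ) (z : ℕ → Z) (y : ℕ → ℝ) :
    noiseSum F (t + 1) z y =
      noiseSum F t z y + (y t - Real.sigmoid (F (z t))) • feature H (z t) :=
  Finset.sum_range_succ _ _

/-- Telescoping of the rank-one update. It turns the one-step Bernoulli bound into a statement about
the norm of the whole noise sum. -/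
lemma sum_selfNormIncr {ρ : ℝ} (hρ : 0 < ρ) (F : H) (t : ℕ) (z : ℕ → Z) (y : ℕ → ℝ) :
    ∑ n ∈ Finset.range t, selfNormIncr (ρ⁻¹ * posteriorVar (scalarKernel H) ρ n z (z n))
        (inner ℝ (noiseSum F n z y) (covInv H ρ n z (feature H (z n))))
        (y n - Real.sigmoid (F (z n))) =
      2 * invCovNorm ρ t z (noiseSum F t z y) ^ 2 := by
  induction t with
  | zero => simp [noiseSum, invCovNorm]
  | succ t ih =>
    rw [Finset.sum_range_succ, ih, invCovNorm_sq hρ, invCovNorm_sq hρ, noiseSum_succ,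
      inner_covInv_succ_add_smul hρ, posteriorVar_eq hρ, inv_mul_cancel_left₀ hρ.ne', selfNormIncr]
    ring

/-- Deterministic confidence bound: the error of the projected estimate in terms of the
self-normalized norm of the noise. -/
lemma abs_estimate_sub_le {B lam : ℝ} (hB : 0 ≤ B) (hlam : 0 < lam)
    (hker : ∀ a : Z, scalarKernel H a a ≤ 4) {F h : H} (hF : ‖F‖ ≤ B) {t : ℕ} {z : ℕ → Z}
    {y : ℕ → ℝ} (hest : IsProjectedEstimate B lam (sigmoidKappa (2 * B)) t z y h) (a : Z) :
    |h a - F a| ≤ 2 * sigmoidKappa (2 * B) * (lam * B / √(lam * sigmoidKappa (2 * B)) +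
      invCovNorm (lam * sigmoidKappa (2 * B)) t z (noiseSum F t z y)) *
      (posteriorStd (scalarKernel H) (lam * sigmoidKappa (2 * B)) t z a /
        √(lam * sigmoidKappa (2 * B))) := by
  obtain ⟨θ, hθ, hhB, hmin⟩ := hest
  set κ := sigmoidKappa (2 * B) with hκ
  have hκ0 : 0 < κ := sigmoidKappa_pos (by linarith)
  set ρ := lam * κ with hρdef
  have hρ : 0 < ρ := mul_pos hlam hκ0
  set N := lam * B / √ρ + invCovNorm ρ t z (noiseSum F t z y) with hN
  -- The diagonal bound 4 gives features of norm at most 2, so values stay in the interval that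
  -- defines κ.
  have hbound : ∀ g : H, ‖g‖ ≤ B → ∀ b : Z, g b ∈ Set.Icc (-(2 * B)) (2 * B) := by
    intro g hg b
    rw [Set.mem_Icc, ← abs_le, mul_comm]
    refine (abs_apply_le g b).trans (mul_le_mul hg ?_ (Real.sqrt_nonneg _) hB)
    rw [Real.sqrt_le_left (by norm_num)]
    exact (hker b).trans (by norm_num)
  -- By the first-order condition for θ, the difference of gradients is the regularization bias lam
  -- F minus the noise sum.
  have hFθ : invCovNorm ρ t z (gradMap lam t z F - gradMap lam t z θ) ≤ N := by
    have : gradMap lam t z F - gradMap lam t z θ = lam • F + -noiseSum F t z y := by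
      rw [gradMap_eq_of_isLogisticMinimizer hθ, gradMap, noiseSum]
      simp only [sub_smul, Finset.sum_sub_distrib]
      abel
    rw [this]
    refine (invCovNorm_add_le hρ t z _ _).trans ?_
    rw [invCovNorm_neg, hN]
    gcongr
    refine (invCovNorm_le_norm hρ t z _).trans ?_
    rw [norm_smul, Real.norm_of_nonneg hlam.le]
    gcongr
  -- F competes in the projection, so h is no farther from θ than F is; the triangle inequality
  -- costs the factor 2.
  have hG : invCovNorm ρ t z (gradMap lam t z h - gradMap lam t z F) ≤ 2 * N := by
    have : gradMap lam t z h - gradMap lam t z F =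
        (gradMap lam t z h - gradMap lam t z θ) + -(gradMap lam t z F - gradMap lam t z θ) := by
      abel
    rw [this]
    refine (invCovNorm_add_le hρ t z _ _).trans ?_
    rw [invCovNorm_neg]
    linarith [hmin F hF]
  set u := h - F with hu
  set Q := inner ℝ u (covOp H ρ t z u) with hQ
  have hQ0 : 0 ≤ Q := le_trans (by positivity) (mul_norm_sq_le_inner_covOp ρ t z u)
  -- The choice ρ = lam κ makes the regularization parts match exactly.
  have hmono : κ⁻¹ * Q ≤ inner ℝ u (gradMap lam t z h - gradMap lam t z F) := by
    rw [hQ, inner_covOp, gradMap, gradMap, inner_sub_right (𝕜 := ℝ) u (_ + _), inner_add_right,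
      inner_add_right, inner_sum, inner_sum]
    simp only [inner_smul_right, inner_feature]
    have h1 : lam * inner ℝ u h - lam * inner ℝ u F = lam * inner ℝ u u := by
      rw [← mul_sub, ← inner_sub_right]
    have h2 : κ⁻¹ * ∑ τ ∈ Finset.range t, u (z τ) * u (z τ) ≤
        ∑ τ ∈ Finset.range t, Real.sigmoid (h (z τ)) * u (z τ) -
        ∑ τ ∈ Finset.range t, Real.sigmoid (F (z τ)) * u (z τ) := by
      rw [← Finset.sum_sub_distrib, Finset.mul_sum]
      refine Finset.sum_le_sum fun τ _ => ?_
      have := sigmoid_sub_mul_sub_ge (hbound h hhB (z τ)) (hbound F hF (z τ))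
      have hval : u (z τ) = h (z τ) - F (z τ) := by rw [hu]; simp
      rw [hval]
      linarith
    have h3 : κ⁻¹ * (ρ * inner ℝ u u) = lam * inner ℝ u u := by
      rw [hρdef]; field_simp
    rw [mul_add, h3]
    linarith
  have hQN : Q ≤ (2 * κ * N) ^ 2 := by
    have hcs := inner_sq_le_covOp_mul_covInv hρ t z u (gradMap lam t z h - gradMap lam t z F)
    rw [← invCovNorm_sq hρ, ← hQ] at hcs
    have h1 : (κ⁻¹ * Q) ^ 2 ≤ Q * (2 * N) ^ 2 := by
      calc _ ≤ _ := pow_le_pow_left₀ (by positivity) hmono 2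
        _ ≤ _ := hcs
        _ ≤ _ := by
          gcongr
          exact invCovNorm_nonneg _ _ _ _
    rcases hQ0.eq_or_lt with h0 | h0
    · rw [← h0]; positivity
    · have h2 : κ⁻¹ ^ 2 * Q ≤ (2 * N) ^ 2 := by
        refine le_of_mul_le_mul_left ?_ h0
        linarith
      calc Q = κ ^ 2 * (κ⁻¹ ^ 2 * Q) := by field_simp
        _ ≤ κ ^ 2 * (2 * N) ^ 2 := by gcongr
        _ = _ := by ring
  have hN0 : 0 ≤ N := le_trans (invCovNorm_nonneg _ _ _ _) hFθ
  have hval : h a - F a = inner ℝ u (feature H a) := by rw [inner_feature, hu]; simp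
  rw [hval]
  refine abs_le_of_sq_le_sq ?_ (by
    have := Real.sqrt_nonneg (posteriorVar (scalarKernel H) ρ t z a)
    rw [← posteriorStd] at this
    positivity)
  have hcs := inner_sq_le_covOp_mul_covInv hρ t z u (feature H a)
  calc _ ≤ _ := hcs
    _ ≤ (2 * κ * N) ^ 2 * inner ℝ (feature H a) (covInv H ρ t z (feature H a)) :=
      mul_le_mul_of_nonneg_right hQN (inner_covInv_self_nonneg hρ t z _)
    _ = _ := by
      rw [mul_pow (2 * κ * N), div_pow, posteriorStd_sq hρ, Real.sq_sqrt hρ.le, posteriorVar_eq hρ,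
        mul_div_cancel_left₀ _ hρ.ne']

/-- The confidence width of the projected estimate on the event where the self-normalized noise is
bounded. -/
lemma abs_estimate_sub_le_of_invCovNorm_sq_le {B lam : ℝ} (hB : 0 ≤ B) (hlam : 0 < lam)
    (hker : ∀ a : Z, scalarKernel H a a ≤ 4) {F h : H} (hF : ‖F‖ ≤ B) {t : ℕ} {z : ℕ → Z}
    {y : ℕ → ℝ} (hest : IsProjectedEstimate B lam (sigmoidKappa (2 * B)) t z y h) {G : ℝ}
    (hG : 2 * invCovNorm (lam * sigmoidKappa (2 * B)) t z (noiseSum F t z y) ^ 2 ≤ G) (a : Z) :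
    |h a - F a| ≤ (2 * B + √(2 * sigmoidKappa (2 * B) / lam * G)) *
      posteriorStd (scalarKernel H) (lam * sigmoidKappa (2 * B)) t z a := by
  refine (abs_estimate_sub_le hB hlam hker hF hest a).trans ?_
  set κ := sigmoidKappa (2 * B) with hκ
  have hκ0 : 0 < κ := sigmoidKappa_pos (by linarith)
  set S := invCovNorm (lam * κ) t z (noiseSum F t z y)
  have hS0 : 0 ≤ S := invCovNorm_nonneg _ _ _ _
  have hσ : 0 ≤ posteriorStd (scalarKernel H) (lam * κ) t z a := Real.sqrt_nonneg _
  have hr : 0 < √(lam * κ) := Real.sqrt_pos.mpr (by positivity)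
  have hsq : √(lam * κ) ^ 2 = lam * κ := Real.sq_sqrt (by positivity)
  have hSle : 2 * κ * S / √(lam * κ) ≤ √(2 * κ / lam * G) := by
    refine Real.le_sqrt_of_sq_le ?_
    rw [div_pow, hsq, div_le_iff₀ (by positivity)]
    have : 2 * κ / lam * G * (lam * κ) = 2 * κ ^ 2 * G := by field_simp
    rw [this]
    nlinarith [sq_nonneg κ]
  calc _ = (2 * κ * (lam * B) / √(lam * κ) ^ 2 + 2 * κ * S / √(lam * κ)) *
        posteriorStd (scalarKernel H) (lam * κ) t z a := by
        field_simp
    _ ≤ _ := by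
        gcongr
        rw [hsq]
        exact le_of_eq (by field_simp)

end Confidence

/-! ## The dueling function space -/

section Dueling

variable {X H HD : Type*} [NormedAddCommGroup H] [InnerProductSpace ℝ H] [CompleteSpace H]
  [RKHS ℝ H X ℝ] [NormedAddCommGroup HD] [InnerProductSpace ℝ HD] [CompleteSpace HD]
  [RKHS ℝ HD (X × X) ℝ]

lemma span_range_feature_dense {Z : Type*} [RKHS ℝ H Z ℝ] :
    Dense (Submodule.span ℝ (Set.range (feature H : Z → H)) : Set H) := by
  rw [Submodule.dense_iff_topologicalClosure_eq_top]
  refine top_le_iff.mp ((RKHS.kerFun_dense (𝕜 := ℝ) H).symm.le.trans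
    (Submodule.topologicalClosure_mono (Submodule.span_le.mpr ?_)))
  rintro _ ⟨x, v, rfl⟩
  have : RKHS.kerFun H x v = v • feature H x := by
    rw [feature, ← map_smul, smul_eq_mul, mul_one]
  rw [this]
  exact Submodule.smul_mem _ _ (Submodule.subset_span ⟨x, rfl⟩)

lemma duelingKernel_eq_inner (a b : X × X) :
    duelingKernel (scalarKernel H) a b =
      inner ℝ (feature H a.1 - feature H a.2) (feature H b.1 - feature H b.2) := by
  simp only [duelingKernel, scalarKernel_eq_inner, inner_sub_left, inner_sub_right]
  ring

/-- Every utility induces a preference function of at most the same norm. -/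
lemma exists_dueling_function
    (hk : scalarKernel HD = duelingKernel (scalarKernel H)) (f : H) :
    ∃ F : HD, ‖F‖ ≤ ‖f‖ ∧ ∀ z : X × X, F z = f z.1 - f z.2 := by
  -- Equal kernels give formal combinations the same norm under e and e'. Hence pairing e' with f
  -- factors through e, extends from its dense range to HD with norm at most ‖f‖, and Riesz
  -- represents it.
  let e : (X × X →₀ ℝ) →ₗ[ℝ] HD := Finsupp.linearCombination ℝ (feature HD)
  let e' : (X × X →₀ ℝ) →ₗ[ℝ] H :=
    Finsupp.linearCombination ℝ fun z : X × X => feature H z.1 - feature H z.2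
  have hnorm : ∀ c, ‖e' c‖ = ‖e c‖ := by
    intro c
    rw [← sq_eq_sq₀ (norm_nonneg _) (norm_nonneg _), ← real_inner_self_eq_norm_sq,
      ← real_inner_self_eq_norm_sq]
    simp only [e, e', Finsupp.linearCombination_apply, Finsupp.sum_inner, Finsupp.inner_sum,
      inner_smul_left, inner_smul_right, ← duelingKernel_eq_inner, ← scalarKernel_eq_inner, hk]
  have hdense : DenseRange e := by
    have h := span_range_feature_dense (H := HD) (Z := X × X)
    rw [← Finsupp.range_linearCombination] at h
    exact h
  let ℓ : (X × X →₀ ℝ) →ₗ[ℝ] ℝ := (innerSL ℝ f).toLinearMap ∘ₗ e'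
  have hℓ : ∀ c, ‖ℓ c‖ ≤ ‖f‖ * ‖e c‖ := fun c => by
    rw [← hnorm]
    exact norm_inner_le_norm f (e' c)
  let Λ : HD →L[ℝ] ℝ := ℓ.extendOfNorm e
  refine ⟨(InnerProductSpace.toDual ℝ HD).symm Λ, ?_, fun z => ?_⟩
  · rw [LinearIsometryEquiv.norm_map]
    exact LinearMap.opNorm_extendOfNorm_le hdense (norm_nonneg f) hℓ
  · rw [← inner_feature, InnerProductSpace.toDual_symm_apply]
    have h := LinearMap.extendOfNorm_eq (f := ℓ) hdense ⟨‖f‖, hℓ⟩ (Finsupp.single z 1)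
    have he : e (Finsupp.single z 1) = feature HD z := by simp [e]
    have hz : ℓ (Finsupp.single z 1) = f z.1 - f z.2 := by
      simp [ℓ, e', inner_sub_right, inner_feature]
    rw [he, hz] at h
    exact h

/-- The dueling kernel is additive along chains of comparisons. Every element of HD inherits this,
so an action that is greedy against `xnull` is greedy against every opponent. -/
lemma feature_dueling_eq_add (hk : scalarKernel HD = duelingKernel (scalarKernel H)) (a b c : X) :
    feature HD (a, c) = feature HD (a, b) + feature HD (b, c) := by
  refine RKHS.ext fun z => ?_
  rw [RKHS.coe_add, Pi.add_apply, feature_apply, feature_apply, feature_apply, hk]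
  simp only [duelingKernel]
  ring

lemma dueling_apply_eq_add (hk : scalarKernel HD = duelingKernel (scalarKernel H)) (h : HD)
    (a b c : X) : h (a, c) = h (a, b) + h (b, c) := by
  rw [← inner_feature, feature_dueling_eq_add hk a b c, inner_add_right, inner_feature,
    inner_feature]

lemma dueling_apply_self (hk : scalarKernel HD = duelingKernel (scalarKernel H)) (h : HD) (a : X) :
    h (a, a) = 0 := by
  have := dueling_apply_eq_add hk h a a a
  linarith

lemma scalarKernel_dueling_le (hk : scalarKernel HD = duelingKernel (scalarKernel H))
    (h1 : ∀ a : X, scalarKernel H a a ≤ 1) (z : X × X) : scalarKernel HD z z ≤ 4 := by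
  rw [hk, duelingKernel_eq_inner, real_inner_self_eq_norm_sq]
  have hn : ∀ a : X, ‖feature H a‖ ≤ 1 := fun a => by
    have := h1 a
    rw [scalarKernel_self] at this
    exact (sq_le_one_iff₀ (norm_nonneg _)).mp this
  have := norm_sub_le (feature H z.1) (feature H z.2)
  nlinarith [hn z.1, hn z.2, norm_nonneg (feature H z.1 - feature H z.2)]

lemma posteriorStd_dueling_self (hk : scalarKernel HD = duelingKernel (scalarKernel H)) {ρ : ℝ}
    (hρ : 0 < ρ) (t : ℕ) (z : ℕ → X × X) (a : X) :
    posteriorStd (scalarKernel HD) ρ t z (a, a) = 0 := by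
  have : feature HD (a, a) = 0 := by
    have := feature_dueling_eq_add hk a a a
    simpa using this
  rw [posteriorStd, posteriorVar_eq hρ, this]
  simp

lemma posteriorStd_dueling_swap (hk : scalarKernel HD = duelingKernel (scalarKernel H)) {ρ : ℝ}
    (hρ : 0 < ρ) (t : ℕ) (z : ℕ → X × X) (a b : X) :
    posteriorStd (scalarKernel HD) ρ t z (a, b) = posteriorStd (scalarKernel HD) ρ t z (b, a) := by
  have h0 : feature HD (a, a) = 0 := by
    have := feature_dueling_eq_add hk a a a
    simpa using this
  have : feature HD (a, b) = -feature HD (b, a) := by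
    rw [eq_neg_iff_add_eq_zero, ← feature_dueling_eq_add hk, h0]
  rw [posteriorStd, posteriorStd, posteriorVar_eq hρ, posteriorVar_eq hρ, this]
  simp

end Dueling

/-! ## One round of information-directed sampling -/

section Round

variable {X : Type*}

/-- Concavity of log between 1 and 1 + 4/ρ, with weight s²/4. It converts squared widths into
information. -/
lemma mul_sq_le_log_one_add {ρ s : ℝ} (hρ : 0 < ρ) (hs0 : 0 ≤ s) (hs : s ≤ 2) :
    Real.log (1 + ρ⁻¹ * 4) / 4 * s ^ 2 ≤ Real.log (1 + ρ⁻¹ * s ^ 2) := by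
  have hρ' : 0 < ρ⁻¹ := inv_pos.mpr hρ
  have h := strictConcaveOn_log_Ioi.concaveOn.2 (show (1 + ρ⁻¹ * 4 : ℝ) ∈ Set.Ioi 0 by
      simp only [Set.mem_Ioi]; positivity) (show (1 : ℝ) ∈ Set.Ioi 0 by simp)
    (show 0 ≤ s ^ 2 / 4 by positivity) (show 0 ≤ 1 - s ^ 2 / 4 by nlinarith) (by ring)
  simp only [smul_eq_mul, Real.log_one, mul_zero, add_zero] at h
  calc _ = s ^ 2 / 4 * Real.log (1 + ρ⁻¹ * 4) := by ring
    _ ≤ _ := h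
    _ = _ := by congr 1; ring

/-- The ratio minimized by the algorithm is at most a multiple of the squared exploration
coefficient. -/
lemma sq_le_of_isIDSChoice {h σ : X × X → ℝ} {b ρ : ℝ} {xnull x₁ x₂ : X} {p : ℝ} (hρ : 0 < ρ)
    (hb : 0 ≤ b) (hadd : ∀ a c d, h (a, d) = h (a, c) + h (c, d)) (hσ0 : ∀ z, 0 ≤ σ z)
    (hσ2 : ∀ z, σ z ≤ 2) (hσself : ∀ a, σ (a, a) = 0)
    (hσswap : ∀ a c, σ (a, c) = σ (c, a))
    (hbdd : BddAbove (Set.range fun x => h (x, x₁) + b * σ (x, x₁)))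
    (hc : IsIDSChoice h σ b ρ xnull x₁ x₂ p) :
    0 ≤ optimisticGain h σ b x₁ ∧ optimisticGain h σ b x₁ ≤ estGap h σ b x₁ x₂ ∧
    ((1 - p) * optimisticGain h σ b x₁ + p * estGap h σ b x₁ x₂) ^ 2 ≤
      4 * b ^ 2 / (Real.log (1 + ρ⁻¹ * 4) / 4) * (p * Real.log (1 + ρ⁻¹ * σ (x₁, x₂) ^ 2)) := by
  obtain ⟨hgreedy, ⟨hp0, hp1⟩, hmin⟩ := hc
  have hself : ∀ a, h (a, a) = 0 := fun a => by have := hadd a a a; linarith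
  have hswap : ∀ a c, h (a, c) = -h (c, a) := fun a c => by
    have := hadd a c a; rw [hself] at this; linarith
  have hle : ∀ x, h (x, x₁) ≤ 0 := fun x => by
    have := hadd x x₁ xnull; have := hgreedy x; linarith
  set u := optimisticGain h σ b x₁ with hu
  have hu0 : 0 ≤ u := by
    have := le_ciSup hbdd x₁
    simp only [hself, hσself, mul_zero, add_zero] at this
    exact this
  have hgap : ∀ x, u ≤ estGap h σ b x₁ x := fun x => by
    rw [estGap, ← hu, hswap]; have := hle x; linarith
  refine ⟨hu0, hgap x₂, ?_⟩
  set c := Real.log (1 + ρ⁻¹ * 4) / 4 with hcdef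
  have hρ' : 0 < ρ⁻¹ := inv_pos.mpr hρ
  have hc0 : 0 < c := by
    have : 0 < Real.log (1 + ρ⁻¹ * 4) := Real.log_pos (by linarith)
    positivity
  have hlog0 : 0 ≤ Real.log (1 + ρ⁻¹ * σ (x₁, x₂) ^ 2) :=
    Real.log_nonneg (by have : 0 ≤ ρ⁻¹ * σ (x₁, x₂) ^ 2 := by positivity
                        linarith)
  have hratio : ∃ x, ∃ q ∈ Set.Icc (0 : ℝ) 1,
      idsRatio h σ b ρ x₁ x q ≤ ENNReal.ofReal (4 * b ^ 2 / c) := by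
    -- If the optimistic gain is 0, taking x₁ with probability 0 gives the ratio 0/0 = 0.
    rcases hu0.eq_or_lt with h0 | h0
    · refine ⟨x₁, 0, by simp, ?_⟩
      simp [idsRatio, ← hu, ← h0]
    · have : Nonempty X := ⟨x₁⟩
      -- The supremum need not be attained; a point above u/2 suffices. As h(x, x₁) ≤ 0, both u/2
      -- and u/2 - h(x, x₁) lie below bσ, so the estimated gap is at most 2bσ.
      obtain ⟨x, hx⟩ := exists_lt_of_lt_ciSup (show u / 2 < ⨆ x, (h (x, x₁) + b * σ (x, x₁)) by
        rw [← optimisticGain, ← hu]; linarith)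
      refine ⟨x, 1, by simp, ?_⟩
      have hbσ : u / 2 < b * σ (x, x₁) := by have := hle x; linarith
      have hbpos : 0 < b := by
        rcases hb.eq_or_lt with h1 | h1
        · rw [← h1] at hbσ; linarith
        · exact h1
      have hσpos : 0 < σ (x, x₁) := by
        rcases (hσ0 (x, x₁)).eq_or_lt with h1 | h1
        · rw [← h1] at hbσ; linarith
        · exact h1
      have hlog := mul_sq_le_log_one_add hρ (hσ0 (x, x₁)) (hσ2 (x, x₁))
      have hgap0 := hgap x
      have hgapx : estGap h σ b x₁ x ≤ 2 * (b * σ (x, x₁)) := by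
        rw [estGap, ← hu, hswap]; linarith
      rw [idsRatio, hσswap x₁ x, sub_self, zero_mul, zero_add, one_mul, one_mul]
      refine ENNReal.div_le_of_le_mul ?_
      rw [← ENNReal.ofReal_mul (by positivity)]
      refine ENNReal.ofReal_le_ofReal ?_
      calc _ ≤ (2 * (b * σ (x, x₁))) ^ 2 := pow_le_pow_left₀ (by linarith) hgapx 2
        _ = 4 * b ^ 2 / c * (c * σ (x, x₁) ^ 2) := by field_simp; ring
        _ ≤ _ := by gcongr
  obtain ⟨x, q, hq, hxq⟩ := hratio
  have h1 := (hmin x q hq).trans hxq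
  rw [idsRatio, ← hu] at h1
  set N := ((1 - p) * u + p * estGap h σ b x₁ x₂) ^ 2 with hN
  set I := p * Real.log (1 + ρ⁻¹ * σ (x₁, x₂) ^ 2) with hI
  have hI0 : 0 ≤ I := mul_nonneg hp0 hlog0
  have h2 := (ENNReal.div_le_iff_le_mul (Or.inr ENNReal.ofReal_ne_top)
    (Or.inl ENNReal.ofReal_ne_top)).1 h1
  rw [← ENNReal.ofReal_mul (by positivity)] at h2
  exact (ENNReal.ofReal_le_ofReal_iff (by positivity)).mp h2

/-- On the confidence event, the gaps of both candidate actions of a round are controlled by the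
square root of the expected information. -/
lemma gaps_le_of_isIDSChoice {f : X → ℝ} {xs : X} {h σ : X × X → ℝ} {b ρ : ℝ}
    {xnull x₁ x₂ : X} {p : ℝ} (hρ : 0 < ρ)
    (hb : 0 ≤ b) (hadd : ∀ a c d, h (a, d) = h (a, c) + h (c, d)) (hσ0 : ∀ z, 0 ≤ σ z)
    (hσ2 : ∀ z, σ z ≤ 2) (hσself : ∀ a, σ (a, a) = 0) (hσswap : ∀ a c, σ (a, c) = σ (c, a))
    (hbdd : BddAbove (Set.range fun x => h (x, x₁) + b * σ (x, x₁)))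
    (hconf : ∀ z : X × X, |h z - (f z.1 - f z.2)| ≤ b * σ z)
    (hc : IsIDSChoice h σ b ρ xnull x₁ x₂ p) :
    f xs - f x₁ ≤ 3 * b / √(Real.log (1 + ρ⁻¹ * 4) / 4) *
      √(p * Real.log (1 + ρ⁻¹ * σ (x₁, x₂) ^ 2)) ∧
    p * (f xs - f x₂) ≤ 3 * b / √(Real.log (1 + ρ⁻¹ * 4) / 4) *
      √(p * Real.log (1 + ρ⁻¹ * σ (x₁, x₂) ^ 2)) := by
  obtain ⟨hu0, hgap, hsq⟩ := sq_le_of_isIDSChoice hρ hb hadd hσ0 hσ2 hσself hσswap hbdd hc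
  obtain ⟨-, ⟨hp0, hp1⟩, -⟩ := hc
  set u := optimisticGain h σ b x₁ with hu
  set Δ := estGap h σ b x₁ x₂ with hΔ
  set c := Real.log (1 + ρ⁻¹ * 4) / 4 with hcdef
  set I := Real.log (1 + ρ⁻¹ * σ (x₁, x₂) ^ 2) with hI
  have hρ' : 0 < ρ⁻¹ := inv_pos.mpr hρ
  have hc0 : 0 < c := by
    have : 0 < Real.log (1 + ρ⁻¹ * 4) := Real.log_pos (by linarith)
    positivity
  have hlog := mul_sq_le_log_one_add hρ (hσ0 (x₁, x₂)) (hσ2 (x₁, x₂))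
  rw [← hcdef, ← hI] at hlog
  have hI0 : 0 ≤ I := le_trans (by positivity) hlog
  have hN : (1 - p) * u + p * Δ ≤ 2 * (b / √c * √(p * I)) := by
    refine abs_le_of_sq_le_sq' ?_ (by positivity) |>.2
    refine hsq.trans (le_of_eq ?_)
    rw [mul_pow, mul_pow, div_pow, Real.sq_sqrt hc0.le, Real.sq_sqrt (by positivity)]
    ring
  have hpσ : p * (b * σ (x₁, x₂)) ≤ b / √c * √(p * I) := by
    -- One of the two factors p is discarded using p ≤ 1.
    have : p * σ (x₁, x₂) ≤ √(p * I) / √c := by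
      rw [le_div_iff₀ (Real.sqrt_pos.mpr hc0)]
      refine Real.le_sqrt_of_sq_le ?_
      rw [mul_pow, mul_pow, Real.sq_sqrt hc0.le]
      calc p ^ 2 * σ (x₁, x₂) ^ 2 * c = p * (p * (c * σ (x₁, x₂) ^ 2)) := by ring
        _ ≤ 1 * (p * I) := by gcongr
        _ = _ := one_mul _
    calc _ = b * (p * σ (x₁, x₂)) := by ring
      _ ≤ b * (√(p * I) / √c) := by gcongr
      _ = _ := by ring
  have h1 : f xs - f x₁ ≤ u := by
    have h := (abs_le.mp (hconf (xs, x₁))).1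
    have h' := le_ciSup hbdd xs
    simp only at h h'
    rw [hu, optimisticGain]
    linarith
  have h2 : f xs - f x₂ ≤ Δ + b * σ (x₁, x₂) := by
    have h := (abs_le.mp (hconf (x₁, x₂))).1
    simp only at h
    rw [hΔ, estGap, ← hu]
    linarith
  have h0 : 0 ≤ b / √c * √(p * I) := by positivity
  have hmul : 3 * b / √c * √(p * I) = 3 * (b / √c * √(p * I)) := by ring
  rw [hmul]
  -- Since u ≤ Δ, both u and pΔ are at most the mixture (1 - p)u + pΔ; the third unit of the
  -- constant 3 pays for the width at x₂.
  constructor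
  · nlinarith
  · nlinarith

end Round

/-! ## Determinants of positive semidefinite matrices -/

section Determinant

variable {n : Type*} [Fintype n] [DecidableEq n]

/-- All eigenvalues of 1 + S are at least 1. -/
lemma one_le_det_one_add {S : Matrix n n ℝ} (hS : S.PosSemidef) : 1 ≤ (1 + S).det := by
  have hH : (1 + S).IsHermitian := Matrix.isHermitian_one.add hS.1
  rw [hH.det_eq_prod_eigenvalues]
  refine Finset.one_le_prod fun i _ => ?_
  have hv : star ⇑(hH.eigenvectorBasis i) ⬝ᵥ ⇑(hH.eigenvectorBasis i) = (1 : ℝ) := by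
    rw [dotProduct_comm, ← EuclideanSpace.inner_eq_star_dotProduct, real_inner_self_eq_norm_sq,
      hH.eigenvectorBasis.orthonormal.1 i, one_pow]
  have h := hS.dotProduct_mulVec_nonneg ⇑(hH.eigenvectorBasis i)
  simp only [RCLike.ofReal_real_eq_id, id_eq]
  rw [hH.eigenvalues_eq, Matrix.add_mulVec, Matrix.one_mulVec, dotProduct_add, hv]
  simpa using h

lemma exists_conjTranspose_mul_self {P : Matrix n n ℝ} (hP : P.PosSemidef) :
    ∃ R : Matrix n n ℝ, P = R.conjTranspose * R := by
  open scoped MatrixOrder Matrix.Norms.L2Operator in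
  exact CStarAlgebra.nonneg_iff_eq_star_mul_self.mp hP.nonneg

lemma det_add_conjTranspose_mul_self {A : Matrix n n ℝ} (hA : A.PosDef) (R : Matrix n n ℝ) :
    (A + R.conjTranspose * R).det = A.det * (1 + R * A⁻¹ * R.conjTranspose).det := by
  have hu := hA.det_pos.ne'.isUnit
  have : A + R.conjTranspose * R = A * (1 + A⁻¹ * R.conjTranspose * R) := by
    rw [mul_add, mul_one, Matrix.mul_assoc, Matrix.mul_nonsing_inv_cancel_left _ _ hu]
  rw [this, Matrix.det_mul, Matrix.det_one_add_mul_comm, Matrix.mul_assoc]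

lemma det_le_det_add {A P : Matrix n n ℝ} (hA : A.PosDef) (hP : P.PosSemidef) :
    A.det ≤ (A + P).det := by
  obtain ⟨R, rfl⟩ := exists_conjTranspose_mul_self hP
  rw [det_add_conjTranspose_mul_self hA]
  exact le_mul_of_one_le_right hA.det_pos.le
    (one_le_det_one_add (hA.inv.posSemidef.mul_mul_conjTranspose_same R))

/-- Write P = RᴴR. The determinant ratio is det(1 + R(1 + A)⁻¹Rᴴ), and (1 + A)⁻¹ ≤ 1 bounds it by
det(1 + RRᴴ), which equals det(1 + P). -/
lemma det_one_add_add_le {A P : Matrix n n ℝ} (hA : A.PosSemidef) (hP : P.PosSemidef) :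
    (1 + A + P).det ≤ (1 + A).det * (1 + P).det := by
  have hA1 : (1 + A).PosDef := Matrix.PosDef.one.add_posSemidef hA
  have hu := hA1.det_pos.ne'.isUnit
  obtain ⟨R, rfl⟩ := exists_conjTranspose_mul_self hP
  rw [det_add_conjTranspose_mul_self hA1]
  refine mul_le_mul_of_nonneg_left ?_ hA1.det_pos.le
  have hinv : (1 - (1 + A)⁻¹).PosSemidef := by
    have h : 1 - (1 + A)⁻¹ = (1 + A)⁻¹ * (A + A.conjTranspose * A) * ((1 + A)⁻¹).conjTranspose := by
      rw [hA1.inv.1.eq, hA.1.eq]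
      have h1 : A + A * A = ((1 + A) - 1) * (1 + A) := by noncomm_ring
      rw [h1, ← Matrix.mul_assoc, Matrix.mul_assoc, Matrix.mul_nonsing_inv _ hu, mul_one, mul_sub,
        Matrix.nonsing_inv_mul _ hu, mul_one]
    rw [h]
    exact (hA.add (Matrix.posSemidef_conjTranspose_mul_self A)).mul_mul_conjTranspose_same _
  have h2 : 1 + R * R.conjTranspose =
      1 + R * (1 + A)⁻¹ * R.conjTranspose + R * (1 - (1 + A)⁻¹) * R.conjTranspose := by
    noncomm_ring
  rw [Matrix.det_one_add_mul_comm R.conjTranspose, h2]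
  exact det_le_det_add
    (Matrix.PosDef.one.add_posSemidef (hA1.inv.posSemidef.mul_mul_conjTranspose_same R))
    (hinv.mul_mul_conjTranspose_same R)

end Determinant

/-! ### Comparison of the two information gains -/

section InfoGainDueling

variable {X H HD : Type*} [NormedAddCommGroup H] [InnerProductSpace ℝ H] [CompleteSpace H]
  [RKHS ℝ H X ℝ] [NormedAddCommGroup HD] [InnerProductSpace ℝ HD] [CompleteSpace HD]
  [RKHS ℝ HD (X × X) ℝ]

/-- The information gain of the dueling kernel is at most four times that of the kernel. -/
lemma infoGain_dueling_le [Nonempty X] (hk : scalarKernel HD = duelingKernel (scalarKernel H))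
    {ρ M : ℝ} (hρ : 0 < ρ) (hM : ∀ a : X, scalarKernel H a a ≤ M) (t : ℕ) :
    infoGain (scalarKernel HD) ρ t ≤ 4 * infoGain (scalarKernel H) ρ t := by
  refine ciSup_le fun z => ?_
  have hρ' : 0 ≤ ρ⁻¹ := (inv_pos.mpr hρ).le
  set K := kernelMatrix (scalarKernel HD) z with hK
  set A := ρ⁻¹ • kernelMatrix (scalarKernel H) fun i => (z i).1 with hA
  set D := ρ⁻¹ • kernelMatrix (scalarKernel H) fun i => (z i).2 with hD
  have hA0 : A.PosSemidef := (posSemidef_kernelMatrix _).smul hρ'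
  have hD0 : D.PosSemidef := (posSemidef_kernelMatrix _).smul hρ'
  -- Parallelogram law: the Gram matrices of differences and of sums add up to twice the kernel
  -- matrices of the two coordinates.
  set P := ρ⁻¹ • Matrix.gram ℝ fun i => feature H (z i).1 + feature H (z i).2 with hP
  have hP0 : P.PosSemidef := (Matrix.posSemidef_gram ℝ _).smul hρ'
  have hsum : 1 + ρ⁻¹ • K + P = 1 + (A + D) + (A + D) := by
    ext i j
    simp only [hK, hP, hA, hD, Matrix.add_apply, Matrix.smul_apply, kernelMatrix, Matrix.of_apply,
      Matrix.gram_apply, hk, duelingKernel, inner_add_left, inner_add_right,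
      ← scalarKernel_eq_inner, smul_eq_mul]
    ring
  have h1 : (1 + ρ⁻¹ • K).det ≤ ((1 + A).det * (1 + D).det) * ((1 + A).det * (1 + D).det) := by
    calc _ ≤ (1 + ρ⁻¹ • K + P).det := det_le_det_add (posDef_one_add_kernelMatrix hρ z) hP0
      _ = (1 + (A + D) + (A + D)).det := by rw [hsum]
      _ ≤ (1 + (A + D)).det * (1 + (A + D)).det := det_one_add_add_le (hA0.add hD0) (hA0.add hD0)
      _ ≤ _ := by
        have h := det_one_add_add_le hA0 hD0
        rw [add_assoc] at h
        have hA1 := (Matrix.PosDef.one.add_posSemidef hA0).det_pos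
        have hD1 := (Matrix.PosDef.one.add_posSemidef hD0).det_pos
        have h0 := (Matrix.PosDef.one.add_posSemidef (hA0.add hD0)).det_pos.le
        gcongr
  have hposA : 0 < (1 + A).det := (Matrix.PosDef.one.add_posSemidef hA0).det_pos
  have hposD : 0 < (1 + D).det := (Matrix.PosDef.one.add_posSemidef hD0).det_pos
  have h2 := Real.log_le_log (posDef_one_add_kernelMatrix hρ z).det_pos h1
  rw [Real.log_mul (by positivity) (by positivity), Real.log_mul hposA.ne' hposD.ne'] at h2
  have hgA := le_ciSup (bddAbove_infoGain hρ hM t) fun i => (z i).1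
  have hgD := le_ciSup (bddAbove_infoGain hρ hM t) fun i => (z i).2
  rw [← infoGain] at hgA hgD
  linarith

end InfoGainDueling

/-! ## Measurability -/

section Measurability

variable {Ω Z H : Type*} [MeasurableSpace Z] [NormedAddCommGroup H] [InnerProductSpace ℝ H]
  [CompleteSpace H] [RKHS ℝ H Z ℝ]

lemma measurable_matrix_det {_ : MeasurableSpace Ω} {t : ℕ} {A : Ω → Matrix (Fin t) (Fin t) ℝ}
    (hA : ∀ i j, Measurable fun ω => A ω i j) : Measurable fun ω => (A ω).det := by
  simp only [Matrix.det_apply]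
  exact Finset.measurable_sum _ fun σ _ =>
    (Finset.measurable_prod _ fun i _ => hA _ _).const_smul _

lemma measurable_matrix_inv {_ : MeasurableSpace Ω} {t : ℕ} {A : Ω → Matrix (Fin t) (Fin t) ℝ}
    (hA : ∀ i j, Measurable fun ω => A ω i j) (i j : Fin t) :
    Measurable fun ω => (A ω)⁻¹ i j := by
  simp only [Matrix.inv_def, Ring.inverse_eq_inv', Matrix.smul_apply, smul_eq_mul,
    Matrix.adjugate_apply]
  refine (measurable_matrix_det hA).inv.mul (measurable_matrix_det fun i' j' => ?_)
  simp only [Matrix.updateRow_apply]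
  split_ifs
  · exact measurable_const
  · exact hA _ _

lemma measurable_posteriorCoef {_ : MeasurableSpace Ω} {k : Z → Z → ℝ}
    (hk : Measurable fun q : Z × Z => k q.1 q.2) (ρ : ℝ) {t : ℕ} {z : ℕ → Ω → Z} {a : Ω → Z}
    (hz : ∀ i < t, Measurable (z i)) (ha : Measurable a) (i : Fin t) :
    Measurable fun ω => posteriorCoef k ρ t (fun τ => z τ ω) (a ω) i := by
  simp only [posteriorCoef, Matrix.mulVec, dotProduct]
  refine Finset.measurable_sum _ fun j _ => (measurable_matrix_inv (fun i' j' => ?_) i j).mul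
    (hk.comp ((hz j j.2).prodMk ha))
  simp only [Matrix.add_apply, kernelMatrix, Matrix.of_apply]
  exact (hk.comp ((hz i' i'.2).prodMk (hz j' j'.2))).add measurable_const

lemma measurable_posteriorVar {_ : MeasurableSpace Ω} {k : Z → Z → ℝ}
    (hk : Measurable fun q : Z × Z => k q.1 q.2) (ρ : ℝ) {t : ℕ} {z : ℕ → Ω → Z} {a : Ω → Z}
    (hz : ∀ i < t, Measurable (z i)) (ha : Measurable a) :
    Measurable fun ω => posteriorVar k ρ t (fun τ => z τ ω) (a ω) := by
  have h : ∀ ω, posteriorVar k ρ t (fun τ => z τ ω) (a ω) = k (a ω) (a ω) -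
      ∑ i : Fin t, k (z i ω) (a ω) * posteriorCoef k ρ t (fun τ => z τ ω) (a ω) i := fun ω => rfl
  simp only [h]
  exact (hk.comp (ha.prodMk ha)).sub (Finset.measurable_sum _ fun i _ =>
    (hk.comp ((hz i i.2).prodMk ha)).mul (measurable_posteriorCoef hk ρ hz ha i))

lemma measurable_kernel_comp {_ : MeasurableSpace Ω} {k : Z → Z → ℝ}
    (hk : Measurable fun q : Z × Z => k q.1 q.2) {a b : Ω → Z} (ha : Measurable a)
    (hb : Measurable b) : Measurable fun ω => k (a ω) (b ω) :=
  hk.comp (ha.prodMk hb)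

/-- The functions of a space with measurable kernel are measurable. -/
lemma measurable_of_measurable_kernel
    (hk : Measurable fun q : Z × Z => scalarKernel H q.1 q.2) (f : H) :
    Measurable fun a => f a := by
  have hspan : ∀ g ∈ Submodule.span ℝ (Set.range (feature H : Z → H)),
      Measurable fun a => g a := by
    intro g hg
    induction hg using Submodule.span_induction with
    | mem g hg =>
      obtain ⟨a, rfl⟩ := hg
      simp only [feature_apply]
      exact measurable_kernel_comp (k := scalarKernel H) hk measurable_id measurable_const
    | zero =>
      simp only [RKHS.coe_zero, Pi.zero_apply]
      exact measurable_const
    | add g g' _ _ h h' =>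
      simp only [RKHS.coe_add, Pi.add_apply]
      exact h.add h'
    | smul c g _ h =>
      simp only [RKHS.coe_smul, Pi.smul_apply]
      exact h.const_smul c
  obtain ⟨g, hg, hlim⟩ :=
    mem_closure_iff_seq_limit.mp (span_range_feature_dense (H := H) (Z := Z) f)
  refine measurable_of_tendsto_metrizable (fun n => hspan (g n) (hg n)) ?_
  rw [tendsto_pi_nhds]
  exact fun a => ((RKHS.continuous_eval a).tendsto f).comp hlim

omit [MeasurableSpace Z] in
lemma inner_noiseSum (F : H) (t : ℕ) (z : ℕ → Z) (y : ℕ → ℝ) (a : Z) :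
    inner ℝ (noiseSum F t z y) (feature H a) =
      ∑ τ ∈ Finset.range t, (y τ - Real.sigmoid (F (z τ))) * scalarKernel H (z τ) a := by
  simp only [noiseSum, sum_inner, inner_smul_left, ← scalarKernel_eq_inner, conj_trivial]

/-- No σ-algebra on H is involved: expanding the inverse by `covInv_feature` leaves finite sums and
matrix entries of kernel values. -/
lemma measurable_inner_noiseSum_covInv {_ : MeasurableSpace Ω}
    (hk : Measurable fun q : Z × Z => scalarKernel H q.1 q.2) {ρ : ℝ} (hρ : 0 < ρ) (F : H) {t : ℕ}
    {z : ℕ → Ω → Z} {a : Ω → Z} {y : ℕ → Ω → ℝ} (hz : ∀ i < t, Measurable (z i))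
    (hy : ∀ i < t, Measurable (y i)) (ha : Measurable a) :
    Measurable fun ω => inner ℝ (noiseSum F t (fun τ => z τ ω) (fun τ => y τ ω))
      (covInv H ρ t (fun τ => z τ ω) (feature H (a ω))) := by
  have hN : ∀ {b : Ω → Z}, Measurable b → Measurable fun ω =>
      inner ℝ (noiseSum F t (fun τ => z τ ω) (fun τ => y τ ω)) (feature H (b ω)) := fun hb => by
    simp only [inner_noiseSum]
    refine Finset.measurable_sum _ fun τ hτ => ?_
    have hτ := Finset.mem_range.mp hτ
    have hF : Measurable fun ω => F (z τ ω) :=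
      (measurable_of_measurable_kernel hk F).comp (hz τ hτ)
    exact ((hy τ hτ).sub (continuous_sigmoid.measurable.comp hF)).mul
      (measurable_kernel_comp (k := scalarKernel H) hk (hz τ hτ) hb)
  simp only [covInv_feature hρ, inner_smul_right, inner_sub_right, inner_sum]
  exact measurable_const.mul ((hN ha).sub (Finset.measurable_sum _ fun i _ =>
    (measurable_posteriorCoef hk ρ hz ha i).mul (hN (hz i i.2))))

end Measurability

/-! ## The regret on the good event -/

section Arithmetic

lemma sum_inv_sqrt_le (T : ℕ) :
    ∑ n ∈ Finset.range T, 1 / √((n : ℝ) + 1) ≤ 2 * √(T : ℝ) := by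
  induction T with
  | zero => simp
  | succ T ih =>
    rw [Finset.sum_range_succ]
    have h : 1 / √((T : ℝ) + 1) ≤ 2 * (√((T : ℝ) + 1) - √(T : ℝ)) := by
      have h0 : 0 < √((T : ℝ) + 1) := Real.sqrt_pos.mpr (by positivity)
      rw [div_le_iff₀ h0]
      have h1 := Real.sq_sqrt (show (0 : ℝ) ≤ (T : ℝ) + 1 by positivity)
      have h2 := Real.sq_sqrt (show (0 : ℝ) ≤ (T : ℝ) by positivity)
      nlinarith [sq_nonneg (√((T : ℝ) + 1) - √(T : ℝ))]
    push_cast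
    linarith

lemma sum_sqrt_le {T : ℕ} {a : ℕ → ℝ} (ha : ∀ n < T, 0 ≤ a n) :
    ∑ n ∈ Finset.range T, √(a n) ≤ √(T * ∑ n ∈ Finset.range T, a n) := by
  refine Real.le_sqrt_of_sq_le ?_
  refine sq_sum_le_card_mul_sum_sq.trans (le_of_eq ?_)
  rw [Finset.card_range]
  congr 1
  exact Finset.sum_congr rfl fun n hn => Real.sq_sqrt (ha n (Finset.mem_range.mp hn))

/-- The 3 counts the processes in the maximal inequality; the additive 2 is absorbed where the
information gain is at least 1. -/
lemma log_three_div {δ : ℝ} (hδ : 0 < δ) :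
    Real.log (3 / δ) ≤ Real.log (1 / δ) + 2 := by
  rw [Real.log_div (by norm_num) hδ.ne', Real.log_div one_ne_zero hδ.ne', Real.log_one]
  have := Real.log_le_sub_one_of_pos (show (0 : ℝ) < 3 by norm_num)
  linarith

end Arithmetic

/-! ### Regret along a fixed path -/

section Pathwise

variable {X H HD : Type*} [NormedAddCommGroup H] [InnerProductSpace ℝ H] [CompleteSpace H]
  [RKHS ℝ H X ℝ] [NormedAddCommGroup HD] [InnerProductSpace ℝ HD] [CompleteSpace HD]
  [RKHS ℝ HD (X × X) ℝ]

/-- Logarithmic increment of the self-normalized supermartingale of the feedback noise. -/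
noncomputable def noiseIncr (F : HD) (ρ : ℝ) (n : ℕ) (z : ℕ → X × X) (y : ℕ → ℝ) : ℝ :=
  selfNormIncr (ρ⁻¹ * posteriorVar (scalarKernel HD) ρ n z (z n))
    (inner ℝ (noiseSum F n z y) (covInv HD ρ n z (feature HD (z n))))
    (y n - Real.sigmoid (F (z n))) -
  1 / 2 * Real.log (1 + ρ⁻¹ * posteriorVar (scalarKernel HD) ρ n z (z n))

/-- The information in the observation of a point. -/
noncomputable def infoTerm {Z : Type*} (k : Z → Z → ℝ) (ρ : ℝ) (n : ℕ) (z : ℕ → Z) (a : Z) : ℝ :=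
  Real.log (1 + ρ⁻¹ * posteriorVar k ρ n z a)

lemma infoTerm_nonneg {Z : Type*} [RKHS ℝ H Z ℝ] {ρ : ℝ} (hρ : 0 < ρ) (n : ℕ) (z : ℕ → Z) (a : Z) :
    0 ≤ infoTerm (scalarKernel H) ρ n z a := by
  refine Real.log_nonneg ?_
  have := mul_nonneg (inv_nonneg.mpr hρ.le) (posteriorVar_nonneg (H := H) hρ n z a)
  linarith

lemma infoTerm_le {Z : Type*} [RKHS ℝ H Z ℝ] {ρ M : ℝ} (hρ : 0 < ρ)
    (hM : ∀ a : Z, scalarKernel H a a ≤ M) (n : ℕ) (z : ℕ → Z) (a : Z) :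
    infoTerm (scalarKernel H) ρ n z a ≤ Real.log (1 + ρ⁻¹ * M) := by
  have h0 := mul_nonneg (inv_nonneg.mpr hρ.le) (posteriorVar_nonneg (H := H) hρ n z a)
  refine Real.log_le_log (by linarith) ?_
  have := mul_le_mul_of_nonneg_left ((posteriorVar_le hρ n z a).trans (hM a))
    (inv_nonneg.mpr hρ.le)
  linarith

/-- The confidence bound in terms of the exploration coefficient, in rounds where the information
gain is not small. -/
lemma abs_estimate_sub_le_confCoef [Nonempty X] {B lam δ : ℝ} (hB : 0 ≤ B) (hlam : 0 < lam)
    (hδ : 0 < δ) (hδ1 : δ ≤ 1)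
    (hker : ∀ a : X × X, scalarKernel HD a a ≤ 4) {F h : HD} (hF : ‖F‖ ≤ B) {n : ℕ}
    {z : ℕ → X × X} {y : ℕ → ℝ}
    (hest : IsProjectedEstimate B lam (sigmoidKappa (2 * B)) n z y h)
    (hn : 1 ≤ infoGain (scalarKernel HD) (lam * sigmoidKappa (2 * B)) (n + 1))
    (hnoise : ∑ k ∈ Finset.range n, noiseIncr F (lam * sigmoidKappa (2 * B)) k z y ≤
      Real.log (3 / δ)) (a : X × X) :
    |h a - F a| ≤ confCoef (scalarKernel HD) (sigmoidLip (2 * B)) (sigmoidKappa (2 * B)) lam B δ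
        (n + 1) / sigmoidLip (2 * B) *
      posteriorStd (scalarKernel HD) (lam * sigmoidKappa (2 * B)) n z a := by
  set κ := sigmoidKappa (2 * B) with hκ
  have hκ0 : 0 < κ := sigmoidKappa_pos (by linarith)
  have hL0 : 0 < sigmoidLip (2 * B) := sigmoidLip_pos (by linarith)
  have hρ : 0 < lam * κ := mul_pos hlam hκ0
  have hsum := sum_selfNormIncr hρ F n z y
  have hlog := sum_log_le_infoGain hρ hker n z
  have hmono := infoGain_mono hρ hker (Nat.le_succ n)
  have hl3 := log_three_div hδ
  have hl0 : 0 ≤ Real.log (1 / δ) := Real.log_nonneg (by rw [le_div_iff₀ hδ]; linarith)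
  simp only [noiseIncr, Finset.sum_sub_distrib, ← Finset.mul_sum] at hnoise
  rw [hsum] at hnoise
  -- The noise event bounds 2‖S‖² by γ + log(1/δ) + 2. As γ ≥ 1 at n + 1, four times γ + log(1/δ)
  -- suffices, and √4 is the leading 2 of the coefficient.
  refine (abs_estimate_sub_le_of_invCovNorm_sq_le hB hlam hker hF hest
    (G := 4 * (infoGain (scalarKernel HD) (lam * κ) (n + 1) + Real.log (1 / δ))) ?_ a).trans ?_
  · rw [Nat.succ_eq_add_one] at hmono
    linarith
  · refine mul_le_mul_of_nonneg_right ?_ (Real.sqrt_nonneg _)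
    rw [confCoef, ← hκ, le_div_iff₀ hL0]
    have hs : √(2 * κ / lam * (4 * (infoGain (scalarKernel HD) (lam * κ) (n + 1)
        + Real.log (1 / δ)))) =
        2 * √(2 * κ / lam * (infoGain (scalarKernel HD) (lam * κ) (n + 1) + Real.log (1 / δ))) := by
      rw [← mul_assoc, mul_comm _ (4 : ℝ), mul_assoc, Real.sqrt_mul (by norm_num),
        show (4 : ℝ) = 2 ^ 2 by norm_num, Real.sqrt_sq (by norm_num)]
    rw [hs]
    nlinarith [mul_nonneg hB hL0.le]

/-- When the information gain is small, all gaps are small. -/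
lemma gap_le_of_infoGain_le_one [Nonempty X] {f : X → ℝ} {xs : X} {B ρ : ℝ} (hB : 0 ≤ B)
    (hρ : 0 < ρ) (hker : ∀ a : X × X, scalarKernel HD a a ≤ 4) {F : HD} (hF : ‖F‖ ≤ B)
    (hFf : ∀ z : X × X, F z = f z.1 - f z.2) {n T : ℕ} (hnT : n < T)
    (hn : infoGain (scalarKernel HD) ρ (n + 1) ≤ 1) (a : X) :
    f xs - f a ≤ B * √(2 * Real.exp 2 * ρ * infoGain (scalarKernel HD) ρ T) *
      (1 / √((n : ℝ) + 1)) := by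
  have h := abs_apply_le F (xs, a)
  have hk := scalarKernel_self_le_of_infoGain_le_one hρ hker hn (xs, a)
  have hmono := infoGain_mono hρ hker (show n + 1 ≤ T from hnT)
  push_cast at hk
  have hk' : scalarKernel HD (xs, a) (xs, a) ≤
      2 * Real.exp 2 * ρ * infoGain (scalarKernel HD) ρ T / ((n : ℝ) + 1) := by
    rw [le_div_iff₀ (by positivity), mul_comm]
    exact hk.trans (by gcongr)
  calc f xs - f a = F (xs, a) := (hFf (xs, a)).symm
    _ ≤ |F (xs, a)| := le_abs_self _
    _ ≤ B * √(2 * Real.exp 2 * ρ * infoGain (scalarKernel HD) ρ T / ((n : ℝ) + 1)) :=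
      h.trans (mul_le_mul hF (Real.sqrt_le_sqrt hk') (Real.sqrt_nonneg _) hB)
    _ = _ := by
      rw [Real.sqrt_div (by have := infoGain_nonneg hρ hker T; positivity)]
      ring

/-- Instantaneous regret in terms of the gaps. -/
lemma instantRegret_le {f : X → ℝ} {xs : X} {B : ℝ} (hxs : ∀ a, f a ≤ f xs)
    (hfB : ∀ a, f xs - f a ≤ 2 * B) (hB : 0 ≤ B) (a₁ a₂ : X) (c : Bool) :
    (Real.sigmoid (f xs - f a₁) + Real.sigmoid (f xs - f (if c then a₂ else a₁)) - 1) / 2 ≤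
      sigmoidLip (2 * B) / 2 * (2 * (f xs - f a₁) + boolReal c * (f xs - f a₂)) := by
  have hlin : ∀ a, Real.sigmoid (f xs - f a) - 1 / 2 ≤ sigmoidLip (2 * B) * (f xs - f a) := by
    intro a
    have h := sigmoid_sub_le (R := 2 * B) (a := 0) (b := f xs - f a) ⟨by linarith, by linarith⟩
      ⟨by linarith [hxs a], hfB a⟩ (by linarith [hxs a])
    rw [Real.sigmoid_zero, sub_zero] at h
    norm_num at h ⊢
    exact h
  have hL0 : 0 < sigmoidLip (2 * B) := sigmoidLip_pos (by linarith)
  have h1 := hlin a₁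
  have hx1 := hxs a₁
  cases c
  · simp only [Bool.false_eq_true, if_false, boolReal, zero_mul, add_zero]
    linarith
  · have h2 := hlin a₂
    simp only [if_true, boolReal, one_mul]
    nlinarith [hxs a₁, hxs a₂]

/-- Constant of the regret bound. -/
noncomputable def regretConst (B lam : ℝ) : ℝ :=
  √(2 * Real.exp 2 * (lam * sigmoidKappa (2 * B))) +
    6 * √(4 + 4 * Real.log (1 + (lam * sigmoidKappa (2 * B))⁻¹ * 4)) /
      √(Real.log (1 + (lam * sigmoidKappa (2 * B))⁻¹ * 4) / 4) +
    (2 * B + 1) / (2 * √(2 * sigmoidKappa (2 * B) / lam))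

lemma regretConst_nonneg {B lam : ℝ} (hB : 0 ≤ B) : 0 ≤ regretConst B lam := by
  unfold regretConst
  positivity

set_option maxHeartbeats 1000000 in
/-- The regret bound on the event where the three exponential processes are bounded. -/
theorem duelingRegret_le [Nonempty X] {B lam δ : ℝ} (hB : 0 ≤ B) (hlam : 0 < lam)
    (hδ : 0 < δ) (hδ1 : δ ≤ 1) (hk : scalarKernel HD = duelingKernel (scalarKernel H))
    (hker : ∀ a : X × X, scalarKernel HD a a ≤ 4) {f : X → ℝ} {xs : X} (hxs : ∀ a, f a ≤ f xs)
    {F : HD} (hF : ‖F‖ ≤ B) (hFf : ∀ z : X × X, F z = f z.1 - f z.2)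
    {L κ ρ Mx : ℝ} (hL : L = sigmoidLip (2 * B)) (hκ : κ = sigmoidKappa (2 * B))
    (hρdef : ρ = lam * κ) (hMx : Mx = Real.log (1 + ρ⁻¹ * 4))
    {β : ℕ → ℝ} (hβ : β = confCoef (scalarKernel HD) L κ lam B δ)
    {xnull : X} {h : ℕ → HD} {x₁ x₂ x x' : ℕ → X} {p : ℕ → ℝ} {α y : ℕ → Bool}
    (hx : ∀ n, x n = x₁ n) (hx' : ∀ n, x' n = if α n then x₂ n else x₁ n)
    (hest : ∀ n, IsProjectedEstimate B lam κ n (fun τ => (x τ, x' τ)) (fun τ => boolReal (y τ))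
      (h n))
    (hchoice : ∀ n, IsIDSChoice (fun z => h n z)
      (posteriorStd (scalarKernel HD) ρ n (fun τ => (x τ, x' τ))) (β (n + 1) / L) ρ xnull
      (x₁ n) (x₂ n) (p n))
    (hnoise : ∀ T, ∑ n ∈ Finset.range T,
      noiseIncr F ρ n (fun τ => (x τ, x' τ)) (fun τ => boolReal (y τ)) ≤ Real.log (3 / δ))
    (hinfo : ∀ T, ∑ n ∈ Finset.range T,
      (p n * (infoTerm (scalarKernel HD) ρ n (fun τ => (x τ, x' τ)) (x₁ n, x₂ n) / Mx) / 2 -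
        boolReal (α n) *
          (infoTerm (scalarKernel HD) ρ n (fun τ => (x τ, x' τ)) (x₁ n, x₂ n) / Mx)) ≤
      Real.log (3 / δ))
    (hgap : ∀ T, ∑ n ∈ Finset.range T,
      (boolReal (α n) * ((f xs - f (x₂ n)) / (2 * B + 1)) -
        2 * p n * ((f xs - f (x₂ n)) / (2 * B + 1))) ≤ Real.log (3 / δ)) (T : ℕ) :
    duelingRegret f xs x x' T ≤ regretConst B lam * β T *
      √(T * (infoGain (scalarKernel HD) ρ T + Real.log (1 / δ))) := by
  have hκ0 : 0 < κ := hκ ▸ sigmoidKappa_pos (by linarith)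
  have hL0 : 0 < L := hL ▸ sigmoidLip_pos (by linarith)
  have hρ : 0 < ρ := hρdef ▸ mul_pos hlam hκ0
  have hMx0 : 0 < Mx := hMx ▸ Real.log_pos (by have := inv_pos.mpr hρ; linarith)
  have hl0 : 0 ≤ Real.log (1 / δ) := Real.log_nonneg (by rw [le_div_iff₀ hδ]; linarith)
  have hl3 := log_three_div hδ
  have hΓ0 := infoGain_nonneg hρ hker
  have hΓmono := infoGain_mono hρ hker
  set Γ := infoGain (scalarKernel HD) ρ with hΓ
  set ℓ := Real.log (1 / δ) with hℓ
  set z : ℕ → X × X := fun τ => (x τ, x' τ) with hz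
  set I : ℕ → ℝ := fun n => infoTerm (scalarKernel HD) ρ n z (x₁ n, x₂ n) with hI
  have hI0 : ∀ n, 0 ≤ I n := fun n => infoTerm_nonneg hρ _ _ _
  have hp0 : ∀ n, 0 ≤ p n := fun n => (hchoice n).2.1.1
  have hp1 : ∀ n, p n ≤ 1 := fun n => (hchoice n).2.1.2
  have hfB : ∀ a, f xs - f a ≤ 2 * B := by
    intro a
    rw [← hFf (xs, a), mul_comm]
    refine (le_abs_self _).trans ((abs_apply_le F (xs, a)).trans
      (mul_le_mul hF ?_ (Real.sqrt_nonneg _) hB))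
    rw [Real.sqrt_le_left (by norm_num)]
    exact (hker _).trans (by norm_num)
  have hβ_eq : ∀ n, β n = 4 * L * B + 2 * L * √(2 * κ / lam * (Γ n + ℓ)) := fun n => by
    rw [hβ, confCoef, hΓ, hρdef]
  have hβmono : Monotone β := fun n m hnm => by
    rw [hβ_eq, hβ_eq]
    have := hΓmono hnm
    gcongr
  have hβ0 : ∀ n, 0 ≤ β n := fun n => by
    rw [hβ_eq]
    positivity
  set c := Real.log (1 + ρ⁻¹ * 4) / 4 with hc
  have hc0 : 0 < c := by rw [hc, ← hMx]; positivity
  set q := √(2 * Real.exp 2 * ρ) with hq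
  -- A bounds the gaps in rounds of small information gain, and G below bounds them in the other
  -- rounds. Both are nonnegative, so A + G covers every round.
  set A : ℕ → ℝ := fun n => B * (q * √(Γ T)) * (1 / √((n : ℝ) + 1)) with hA
  have hA0 : ∀ n, 0 ≤ A n := fun n => by positivity
  set G : ℕ → ℝ := fun n => 3 * (β T / L) / √c * √(p n * I n) with hG
  have hG0 : ∀ n, 0 ≤ G n := fun n => by have := hβ0 T; positivity
  set E := √(T * (Γ T + ℓ)) with hE
  have hbad : ∀ n < T, Γ (n + 1) ≤ 1 → ∀ a, f xs - f a ≤ A n := by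
    intro n hn h1 a
    have h := gap_le_of_infoGain_le_one (xs := xs) hB hρ hker hF hFf hn h1 a
    rwa [Real.sqrt_mul (by positivity)] at h
  have hAsum : ∑ n ∈ Finset.range T, A n ≤ 2 * B * q * E := by
    rw [hA, ← Finset.mul_sum]
    calc _ ≤ B * (q * √(Γ T)) * (2 * √(T : ℝ)) := by gcongr; exact sum_inv_sqrt_le T
      _ = 2 * B * q * √(T * Γ T) := by rw [Real.sqrt_mul (by positivity)]; ring
      _ ≤ _ := by rw [hE]; gcongr; linarith
  have hreg : duelingRegret f xs x x' T ≤ L / 2 * ∑ n ∈ Finset.range T,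
      (2 * (f xs - f (x₁ n)) + boolReal (α n) * (f xs - f (x₂ n))) := by
    rw [duelingRegret, Finset.mul_sum]
    refine Finset.sum_le_sum fun n _ => ?_
    rw [hx, hx', hL]
    exact instantRegret_le hxs hfB hB _ _ _
  have hround : ∀ n < T, f xs - f (x₁ n) ≤ A n + G n ∧ p n * (f xs - f (x₂ n)) ≤ A n + G n := by
    intro n hn
    rcases le_total (Γ (n + 1)) 1 with h1 | h1
    · have h2 := hbad n hn h1 (x₁ n)
      have h3 := hbad n hn h1 (x₂ n)
      have h4 := hG0 n
      refine ⟨by linarith, ?_⟩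
      have h5 : p n * (f xs - f (x₂ n)) ≤ 1 * (f xs - f (x₂ n)) :=
        mul_le_mul_of_nonneg_right (hp1 n) (sub_nonneg.mpr (hxs _))
      linarith
    · have hb0 : 0 ≤ β (n + 1) / L := div_nonneg (hβ0 _) hL0.le
      have hconf : ∀ a : X × X, |h n a - (f a.1 - f a.2)| ≤
          β (n + 1) / L * posteriorStd (scalarKernel HD) ρ n z a := by
        intro a
        subst hL hκ hρdef hβ
        rw [← hFf]
        exact abs_estimate_sub_le_confCoef hB hlam hδ hδ1 hker hF (hest n) h1 (hnoise n) a
      have hσ2 : ∀ a, posteriorStd (scalarKernel HD) ρ n z a ≤ 2 := fun a => by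
        rw [posteriorStd, Real.sqrt_le_left (by norm_num)]
        exact (posteriorVar_le hρ n z a).trans ((hker a).trans (by norm_num))
      have hbdd : BddAbove (Set.range fun a => h n (a, x₁ n) +
          β (n + 1) / L * posteriorStd (scalarKernel HD) ρ n z (a, x₁ n)) := by
        refine ⟨‖h n‖ * 2 + β (n + 1) / L * 2, ?_⟩
        rintro _ ⟨a, rfl⟩
        refine add_le_add ?_ (mul_le_mul_of_nonneg_left (hσ2 _) hb0)
        refine (le_abs_self _).trans ((abs_apply_le (h n) _).trans
          (mul_le_mul_of_nonneg_left ?_ (norm_nonneg _)))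
        rw [Real.sqrt_le_left (by norm_num)]
        exact (hker _).trans (by norm_num)
      obtain ⟨h2, h3⟩ := gaps_le_of_isIDSChoice (f := f) (xs := xs)
        (σ := posteriorStd (scalarKernel HD) ρ n z) hρ hb0
        (dueling_apply_eq_add hk (h n)) (fun a => Real.sqrt_nonneg _) hσ2
        (posteriorStd_dueling_self hk hρ n z) (posteriorStd_dueling_swap hk hρ n z) hbdd hconf
        (hchoice n)
      rw [posteriorStd_sq hρ] at h2 h3
      have hle : 3 * (β (n + 1) / L) / √c * √(p n * I n) ≤ G n := by
        have := hβmono (show n + 1 ≤ T from hn)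
        simp only [hG]
        gcongr
      have h4 := hA0 n
      exact ⟨(h2.trans hle).trans (by linarith), (h3.trans hle).trans (by linarith)⟩
  have hE0 : 0 ≤ E := Real.sqrt_nonneg _
  have hLB : 4 * L * B ≤ β T := by
    rw [hβ_eq, le_add_iff_nonneg_right]; positivity
  -- The three terms pay for the rounds of small gain, for the information ratio, and for the coin
  -- fluctuations of the gaps of x₂.
  have hconst : regretConst B lam = q + 6 * √(4 + 4 * Mx) / √c +
      (2 * B + 1) / (2 * √(2 * κ / lam)) := by
    rw [regretConst, hq, hc, hMx, hρdef, hκ]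
  have hr : 0 < √(2 * κ / lam) := Real.sqrt_pos.mpr (by positivity)
  rw [hconst]
  -- If Γ T ≤ 1, every round has small gain and the bound is deterministic. This avoids log(3/δ),
  -- which β could not absorb here.
  rcases le_total (Γ T) 1 with h1 | h1
  · have hs : ∑ n ∈ Finset.range T,
        (2 * (f xs - f (x₁ n)) + boolReal (α n) * (f xs - f (x₂ n))) ≤
        ∑ n ∈ Finset.range T, 3 * A n := by
      refine Finset.sum_le_sum fun n hn => ?_
      have hn := Finset.mem_range.mp hn
      have hn1 := (hΓmono (show n + 1 ≤ T from hn)).trans h1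
      have h2 := hbad n hn hn1 (x₁ n)
      have h3 := hbad n hn hn1 (x₂ n)
      have h4 : boolReal (α n) * (f xs - f (x₂ n)) ≤ 1 * (f xs - f (x₂ n)) :=
        mul_le_mul_of_nonneg_right (boolReal_le_one _) (sub_nonneg.mpr (hxs _))
      linarith
    rw [← Finset.mul_sum] at hs
    calc _ ≤ _ := hreg
      _ ≤ L / 2 * (3 * (2 * B * q * E)) := by gcongr; linarith
      _ = 3 / 4 * q * (4 * L * B) * E := by ring
      _ ≤ (q + 6 * √(4 + 4 * Mx) / √c + (2 * B + 1) / (2 * √(2 * κ / lam))) * β T * E := by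
        have h2 : 0 ≤ 6 * √(4 + 4 * Mx) / √c := by positivity
        have h3 : 0 ≤ (2 * B + 1) / (2 * √(2 * κ / lam)) := by positivity
        have h4 : 0 ≤ q := Real.sqrt_nonneg _
        gcongr
        linarith
  · have hT1 : (1 : ℝ) ≤ T := by
      rcases Nat.eq_zero_or_pos T with h0 | h0
      · rw [h0, hΓ, infoGain_zero] at h1; linarith
      · exact_mod_cast h0
    set s₁ := ∑ n ∈ Finset.range T, (f xs - f (x₁ n)) with hs₁
    set s₂ := ∑ n ∈ Finset.range T, boolReal (α n) * (f xs - f (x₂ n)) with hs₂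
    set s₃ := ∑ n ∈ Finset.range T, p n * (f xs - f (x₂ n)) with hs₃
    set g := ∑ n ∈ Finset.range T, p n * I n with hg
    have hsum1 : s₁ ≤ ∑ n ∈ Finset.range T, A n + ∑ n ∈ Finset.range T, G n := by
      rw [← Finset.sum_add_distrib]
      exact Finset.sum_le_sum fun n hn => (hround n (Finset.mem_range.mp hn)).1
    have hsum3 : s₃ ≤ ∑ n ∈ Finset.range T, A n + ∑ n ∈ Finset.range T, G n := by
      rw [← Finset.sum_add_distrib]
      exact Finset.sum_le_sum fun n hn => (hround n (Finset.mem_range.mp hn)).2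
    have hsum2 : s₂ ≤ 2 * s₃ + (2 * B + 1) * Real.log (3 / δ) := by
      have h2 := hgap T
      have h3 : ∑ n ∈ Finset.range T, (boolReal (α n) * ((f xs - f (x₂ n)) / (2 * B + 1)) -
          2 * p n * ((f xs - f (x₂ n)) / (2 * B + 1))) = (s₂ - 2 * s₃) / (2 * B + 1) := by
        rw [hs₂, hs₃, Finset.mul_sum, ← Finset.sum_sub_distrib, Finset.sum_div]
        exact Finset.sum_congr rfl fun n _ => by ring
      rw [h3, div_le_iff₀ (by positivity)] at h2
      linarith
    have hobs : ∑ n ∈ Finset.range T, boolReal (α n) * I n ≤ 2 * Γ T := by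
      refine le_trans (Finset.sum_le_sum fun n _ => ?_) (sum_log_le_infoGain hρ hker T z)
      have hzn : z n = (x₁ n, if α n then x₂ n else x₁ n) := by simp only [hz]; rw [hx, hx']
      rcases hα : α n with _ | _
      · simp only [boolReal, Bool.false_eq_true, if_false, zero_mul]
        exact infoTerm_nonneg hρ n z (z n)
      · rw [hα, if_pos rfl] at hzn
        simp only [boolReal, if_true, one_mul, hzn]
        exact le_rfl
    have hgle : g ≤ (4 + 4 * Mx) * (Γ T + ℓ) := by
      have h2 := hinfo T
      have h3 : ∑ n ∈ Finset.range T, (p n * (I n / Mx) / 2 - boolReal (α n) * (I n / Mx)) =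
          (g / 2 - ∑ n ∈ Finset.range T, boolReal (α n) * I n) / Mx := by
        rw [hg, Finset.sum_div, ← Finset.sum_sub_distrib, Finset.sum_div]
        exact Finset.sum_congr rfl fun n _ => by ring
      simp only [hI] at h3
      rw [h3, div_le_iff₀ hMx0] at h2
      simp only [hI] at hobs
      have h4 : Real.log (3 / δ) * Mx ≤ 2 * (Γ T + ℓ) * Mx := by gcongr; linarith
      linarith
    have hg0 : 0 ≤ g := Finset.sum_nonneg fun n _ => mul_nonneg (hp0 n) (hI0 n)
    have hGsum : ∑ n ∈ Finset.range T, G n ≤ 3 * (β T / L) / √c * (√(4 + 4 * Mx) * E) := by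
      rw [hG, ← Finset.mul_sum]
      have hβT := hβ0 T
      gcongr
      refine (sum_sqrt_le fun n _ => mul_nonneg (hp0 n) (hI0 n)).trans ?_
      rw [hE, ← Real.sqrt_mul (by positivity)]
      refine Real.sqrt_le_sqrt ?_
      calc (T : ℝ) * g ≤ T * ((4 + 4 * Mx) * (Γ T + ℓ)) := by gcongr
        _ = _ := by ring
    -- As Γ T ≥ 1, the logarithm is at most 2(Γ T + ℓ). One square root of this is absorbed by β T
    -- and the other by E, using T ≥ 1.
    have hlogle : L * Real.log (3 / δ) ≤ β T * E / √(2 * κ / lam) := by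
      have hΓℓ : 0 ≤ Γ T + ℓ := by linarith
      have h2 : √(Γ T + ℓ) ≤ E := by
        rw [hE]
        exact Real.sqrt_le_sqrt (le_mul_of_one_le_left hΓℓ hT1)
      have h3 : 2 * L * (√(2 * κ / lam) * √(Γ T + ℓ)) ≤ β T := by
        rw [hβ_eq, ← Real.sqrt_mul (by positivity), le_add_iff_nonneg_left]
        positivity
      have h4 : Real.log (3 / δ) ≤ 2 * (√(Γ T + ℓ) * √(Γ T + ℓ)) := by
        rw [Real.mul_self_sqrt hΓℓ]; linarith
      rw [le_div_iff₀ hr]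
      calc L * Real.log (3 / δ) * √(2 * κ / lam)
          ≤ L * (2 * (√(Γ T + ℓ) * √(Γ T + ℓ))) * √(2 * κ / lam) := by gcongr
        _ = 2 * L * (√(2 * κ / lam) * √(Γ T + ℓ)) * √(Γ T + ℓ) := by ring
        _ ≤ β T * E := by
          have := hβ0 T
          gcongr
    have hsplit : ∑ n ∈ Finset.range T,
        (2 * (f xs - f (x₁ n)) + boolReal (α n) * (f xs - f (x₂ n))) = 2 * s₁ + s₂ := by
      rw [Finset.sum_add_distrib, ← Finset.mul_sum]
    rw [hsplit] at hreg
    have htot : 2 * s₁ + s₂ ≤ 4 * (2 * B * q * E +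
        3 * (β T / L) / √c * (√(4 + 4 * Mx) * E)) + (2 * B + 1) * Real.log (3 / δ) := by
      linarith
    have hq0 : 0 ≤ q := Real.sqrt_nonneg _
    calc _ ≤ _ := hreg
      _ ≤ L / 2 * (4 * (2 * B * q * E +
          3 * (β T / L) / √c * (√(4 + 4 * Mx) * E)) + (2 * B + 1) * Real.log (3 / δ)) := by
        gcongr
      _ = q * (4 * L * B) * E + 6 * √(4 + 4 * Mx) / √c * β T * E +
          (2 * B + 1) / 2 * (L * Real.log (3 / δ)) := by
        field_simp
        ring
      _ ≤ q * β T * E + 6 * √(4 + 4 * Mx) / √c * β T * E +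
          (2 * B + 1) / 2 * (β T * E / √(2 * κ / lam)) := by gcongr
      _ = _ := by
        field_simp

end Pathwise

/-! ## The supermartingales of a run -/

section Run

variable {X H HD Ω : Type*} [MeasurableSpace X] [NormedAddCommGroup H] [InnerProductSpace ℝ H]
  [CompleteSpace H] [RKHS ℝ H X ℝ] [NormedAddCommGroup HD] [InnerProductSpace ℝ HD]
  [CompleteSpace HD] [RKHS ℝ HD (X × X) ℝ] {mΩ : MeasurableSpace Ω} {μ : Measure Ω}

lemma measurable_duelingKernel {k : X → X → ℝ} (hk : Measurable fun q : X × X => k q.1 q.2) :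
    Measurable fun q : (X × X) × (X × X) => duelingKernel k q.1 q.2 := by
  have h : ∀ {a b : (X × X) × (X × X) → X}, Measurable a → Measurable b →
      Measurable fun q => k (a q) (b q) := fun ha hb => measurable_kernel_comp hk ha hb
  have h1 : Measurable fun q : (X × X) × (X × X) => q.1.1 := measurable_fst.fst
  have h2 : Measurable fun q : (X × X) × (X × X) => q.1.2 := measurable_fst.snd
  have h3 : Measurable fun q : (X × X) × (X × X) => q.2.1 := measurable_snd.fst
  have h4 : Measurable fun q : (X × X) × (X × X) => q.2.2 := measurable_snd.snd
  exact (((h h1 h3).add (h h2 h4)).sub (h h1 h4)).sub (h h2 h3)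

lemma measurable_selfNormIncr {m : MeasurableSpace Ω} {w r e : Ω → ℝ} (hw : Measurable[m] w)
    (hr : Measurable[m] r) (he : Measurable[m] e) :
    Measurable[m] fun ω => selfNormIncr (w ω) (r ω) (e ω) := by
  unfold selfNormIncr
  fun_prop

/-- A uniform bound, on an event of probability at least `1 - δ`, for the exponential processes of
the noise, of the collected information and of the gaps of the informative actions. -/
lemma IsIDSRun.measure_ge [IsProbabilityMeasure μ] {𝒢 : Filtration ℕ mΩ} {f : X → ℝ}
    {B lam κ : ℝ} {b : ℕ → ℝ} {xnull : X} {h : ℕ → Ω → HD} {x₁ x₂ x x' : ℕ → Ω → X}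
    {p : ℕ → Ω → ℝ} {α y : ℕ → Ω → Bool}
    (hrun : IsIDSRun μ 𝒢 f B lam κ b xnull h x₁ x₂ p α x x' y)
    (hkm : Measurable fun q : (X × X) × (X × X) => scalarKernel HD q.1 q.2)
    (hker : ∀ a : X × X, scalarKernel HD a a ≤ 4) (hfm : Measurable f) {xs : X}
    (hxs : ∀ a, f a ≤ f xs) (hB : 0 ≤ B) (hfB : ∀ a, f xs - f a ≤ 2 * B)
    {F : HD} (hFf : ∀ z : X × X, F z = f z.1 - f z.2)
    {ρ Mx : ℝ} (hρ : 0 < ρ) (hMx : Mx = Real.log (1 + ρ⁻¹ * 4)) {δ : ℝ} (hδ : 0 < δ) :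
    μ {ω | ∃ T, ∃ i : Fin 3, Real.log (3 / δ) ≤ ∑ n ∈ Finset.range T,
      ![noiseIncr F ρ n (fun τ => (x τ ω, x' τ ω)) (fun τ => boolReal (y τ ω)),
        p n ω * (infoTerm (scalarKernel HD) ρ n (fun τ => (x τ ω, x' τ ω)) (x₁ n ω, x₂ n ω) / Mx)
            / 2 - boolReal (α n ω) *
          (infoTerm (scalarKernel HD) ρ n (fun τ => (x τ ω, x' τ ω)) (x₁ n ω, x₂ n ω) / Mx),
        boolReal (α n ω) * ((f xs - f (x₂ n ω)) / (2 * B + 1)) -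
          2 * p n ω * ((f xs - f (x₂ n ω)) / (2 * B + 1))] i} ≤ ENNReal.ofReal δ := by
  have hMx0 : 0 < Mx := hMx ▸ Real.log_pos (by have := inv_pos.mpr hρ; linarith)
  -- The information after the coin but before the feedback: the played pair is known, and the noise
  -- is centred conditionally on it.
  let 𝒦 : ℕ → MeasurableSpace Ω := fun n => 𝒢 n ⊔ MeasurableSpace.comap (α n) ⊤
  have h𝒦 : ∀ n, 𝒦 n ≤ 𝒢 (n + 1) := fun n =>
    sup_le (𝒢.mono (Nat.le_succ n)) (hrun.measurable_coin n).comap_le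
  have hα : ∀ n, Measurable[𝒦 n] (α n) := fun n =>
    (comap_measurable (α n)).mono le_sup_right le_rfl
  have hx : ∀ n, Measurable[𝒦 n] (x n) := fun n => by
    have : x n = x₁ n := funext (hrun.play_fst n)
    rw [this]
    exact (hrun.measurable_fst n).mono le_sup_left le_rfl
  have hx' : ∀ n, Measurable[𝒦 n] (x' n) := fun n => by
    have : x' n = fun ω => if α n ω = true then x₂ n ω else x₁ n ω := funext (hrun.play_snd n)
    rw [this]
    exact Measurable.ite (hα n (measurableSet_singleton true))
      ((hrun.measurable_snd n).mono le_sup_left le_rfl)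
      ((hrun.measurable_fst n).mono le_sup_left le_rfl)
  let z : ℕ → Ω → X × X := fun n ω => (x n ω, x' n ω)
  have hz : ∀ n, Measurable[𝒦 n] (z n) := fun n => (hx n).prodMk (hx' n)
  have hzlt : ∀ n, ∀ i < n, Measurable[𝒢 n] (z i) := fun n i hi =>
    (hz i).mono ((h𝒦 i).trans (𝒢.mono hi)) le_rfl
  have hzlt' : ∀ n, ∀ i < n, Measurable[𝒦 n] (z i) := fun n i hi =>
    (hzlt n i hi).mono le_sup_left le_rfl
  have hylt : ∀ n, ∀ i < n, Measurable[𝒦 n] fun ω => boolReal (y i ω) := fun n i hi =>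
    (measurable_boolReal.comp (hrun.measurable_feedback i)).mono
      ((𝒢.mono hi).trans le_sup_left) le_rfl
  have hFm : Measurable fun a => F a := measurable_of_measurable_kernel hkm F
  let w : ℕ → Ω → ℝ := fun n ω =>
    ρ⁻¹ * posteriorVar (scalarKernel HD) ρ n (fun τ => z τ ω) (z n ω)
  let r : ℕ → Ω → ℝ := fun n ω => inner ℝ (noiseSum F n (fun τ => z τ ω) fun τ => boolReal (y τ ω))
    (covInv HD ρ n (fun τ => z τ ω) (feature HD (z n ω)))
  have hw0 : ∀ n ω, 0 ≤ w n ω := fun n ω =>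
    mul_nonneg (inv_nonneg.mpr hρ.le) (posteriorVar_nonneg hρ _ _ _)
  have hwm : ∀ n, Measurable[𝒦 n] (w n) := fun n =>
    measurable_const.mul (measurable_posteriorVar hkm ρ (hzlt' n) (hz n))
  have hrm : ∀ n, Measurable[𝒦 n] (r n) := fun n =>
    measurable_inner_noiseSum_covInv hkm hρ F (hzlt' n) (hylt n) (hz n)
  have hsm : ∀ n, Measurable[𝒦 n] fun ω => Real.sigmoid (F (z n ω)) := fun n =>
    continuous_sigmoid.measurable.comp (hFm.comp (hz n))
  let D₁ : ℕ → Bool → Ω → ℝ := fun n c ω =>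
    selfNormIncr (w n ω) (r n ω) (boolReal c - Real.sigmoid (F (z n ω))) -
      1 / 2 * Real.log (1 + w n ω)
  have hD₁m : ∀ n c, Measurable[𝒦 n] (D₁ n c) := fun n c =>
    (measurable_selfNormIncr (hwm n) (hrm n) (measurable_const.sub (hsm n))).sub
      (measurable_const.mul (Real.measurable_log.comp (measurable_const.add (hwm n))))
  have hexp₁ : ∀ n, IsExpIncrement μ (𝒢 n) fun ω => D₁ n (y n ω) ω := by
    intro n
    refine IsExpIncrement.mono (m' := 𝒦 n) ?_ le_sup_left
    refine isExpIncrement_of_binary ((h𝒦 n).trans (𝒢.le _))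
      ((hrun.measurable_feedback n).mono (𝒢.le _) le_rfl) (hrun.feedback n) (hD₁m n) ?_
    refine Filter.Eventually.of_forall fun ω h0 h1 => ?_
    have hF : F (z n ω) = f (x n ω) - f (x' n ω) := hFf (z n ω)
    rw [← hF] at h0 h1 ⊢
    have h := bernoulli_selfNorm_le h0 h1 (hw0 n ω) (r n ω)
    have hpos : 0 < 1 + w n ω := by have := hw0 n ω; linarith
    have hsqrt : Real.exp (1 / 2 * Real.log (1 + w n ω)) = √(1 + w n ω) := by
      rw [Real.sqrt_eq_rpow, Real.rpow_def_of_pos hpos, mul_comm]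
    simp only [D₁, Real.exp_sub, hsqrt, boolReal, if_true, Bool.false_eq_true, if_false]
    rw [← mul_div_assoc, ← mul_div_assoc, ← add_div, div_le_one (Real.sqrt_pos.mpr hpos)]
    exact h
  -- Dividing by Mx, the largest possible information term, brings v into [0, 1], as the Bernoulli
  -- tail bound requires.
  let v : ℕ → Ω → ℝ := fun n ω =>
    infoTerm (scalarKernel HD) ρ n (fun τ => z τ ω) (x₁ n ω, x₂ n ω) / Mx
  have hvm : ∀ n, Measurable[𝒢 n] (v n) := fun n =>
    (Real.measurable_log.comp (measurable_const.add (measurable_const.mul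
      (measurable_posteriorVar hkm ρ (hzlt n)
        ((hrun.measurable_fst n).prodMk (hrun.measurable_snd n)))))).div_const Mx
  have hv0 : ∀ n ω, 0 ≤ v n ω := fun n ω => div_nonneg (infoTerm_nonneg hρ _ _ _) hMx0.le
  have hv1 : ∀ n ω, v n ω ≤ 1 := fun n ω => by
    rw [div_le_one hMx0, hMx]
    exact infoTerm_le hρ hker _ _ _
  have hpm := hrun.measurable_prob
  have hbinary : ∀ n {D : Bool → Ω → ℝ}, (∀ c, Measurable[𝒢 n] (D c)) →
      (∀ ω, 0 ≤ p n ω → (1 - p n ω) * Real.exp (D false ω) + p n ω * Real.exp (D true ω) ≤ 1) →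
      IsExpIncrement μ (𝒢 n) fun ω => D (α n ω) ω := fun n D hD hle =>
    isExpIncrement_of_binary (𝒢.le n) ((hrun.measurable_coin n).mono (𝒢.le _) le_rfl)
      (hrun.coin n) hD (Filter.Eventually.of_forall fun ω h0 _ => hle ω h0)
  let D₂ : ℕ → Bool → Ω → ℝ := fun n c ω => p n ω * v n ω / 2 - boolReal c * v n ω
  have hD₂m : ∀ n c, Measurable[𝒢 n] (D₂ n c) := fun n c =>
    (((hpm n).mul (hvm n)).div_const 2).sub (measurable_const.mul (hvm n))
  have hexp₂ : ∀ n, IsExpIncrement μ (𝒢 n) fun ω => D₂ n (α n ω) ω := fun n =>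
    hbinary n (hD₂m n) fun ω h0 => by
      have h := bernoulli_exp_lower_le h0 (hv0 n ω) (hv1 n ω)
      simpa [D₂, boolReal] using h
  -- Normalizing by 2B + 1 rather than 2B also covers B = 0.
  let u : ℕ → Ω → ℝ := fun n ω => (f xs - f (x₂ n ω)) / (2 * B + 1)
  have hum : ∀ n, Measurable[𝒢 n] (u n) := fun n =>
    (measurable_const.sub (hfm.comp (hrun.measurable_snd n))).div_const _
  have hu0 : ∀ n ω, 0 ≤ u n ω := fun n ω =>
    div_nonneg (sub_nonneg.mpr (hxs _)) (by linarith)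
  have hu1 : ∀ n ω, u n ω ≤ 1 := fun n ω => by
    rw [div_le_one (by linarith)]
    linarith [hfB (x₂ n ω)]
  let D₃ : ℕ → Bool → Ω → ℝ := fun n c ω => boolReal c * u n ω - 2 * p n ω * u n ω
  have hD₃m : ∀ n c, Measurable[𝒢 n] (D₃ n c) := fun n c =>
    (measurable_const.mul (hum n)).sub ((measurable_const.mul (hpm n)).mul (hum n))
  have hexp₃ : ∀ n, IsExpIncrement μ (𝒢 n) fun ω => D₃ n (α n ω) ω := fun n =>
    hbinary n (hD₃m n) fun ω h0 => by
      have h := bernoulli_exp_upper_le h0 (hu0 n ω) (hu1 n ω)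
      simpa [D₃, boolReal] using h
  have hbool : ∀ n (m : MeasurableSpace Ω) (Y : Ω → Bool) (D : ℕ → Bool → Ω → ℝ),
      Measurable[m] Y → (∀ c, Measurable[m] (D n c)) → Measurable[m] fun ω => D n (Y ω) ω := by
    intro n m Y D hY hD
    have : (fun ω => D n (Y ω) ω) = fun ω => if Y ω = true then D n true ω else D n false ω := by
      funext ω; cases Y ω <;> simp
    rw [this]
    exact Measurable.ite (hY (measurableSet_singleton true)) (hD true) (hD false)
  have key := measure_exists_sum_ge_le (μ := μ) 𝒢
    (D := ![fun n ω => D₁ n (y n ω) ω, fun n ω => D₂ n (α n ω) ω, fun n ω => D₃ n (α n ω) ω])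
    (fun i n => by
      fin_cases i
      · exact hbool n _ _ D₁ (hrun.measurable_feedback n) fun c => (hD₁m n c).mono (h𝒦 n) le_rfl
      · exact hbool n _ _ D₂ (hrun.measurable_coin n) fun c =>
          (hD₂m n c).mono (𝒢.mono (Nat.le_succ n)) le_rfl
      · exact hbool n _ _ D₃ (hrun.measurable_coin n) fun c =>
          (hD₃m n c).mono (𝒢.mono (Nat.le_succ n)) le_rfl)
    (fun i n => by
      fin_cases i
      · exact hexp₁ n
      · exact hexp₂ n
      · exact hexp₃ n) hδ
  refine le_trans (measure_mono ?_) key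
  rintro ω ⟨T, i, hi⟩
  refine ⟨T, i, ?_⟩
  rw [Fintype.card_fin]
  push_cast
  refine hi.trans (le_of_eq (Finset.sum_congr rfl fun n _ => ?_))
  fin_cases i <;> rfl

end Run

end DuelingIDS

/-! ### The main theorem -/

theorem mainTheorem7 (B lam : ℝ) (hlam : 0 < lam) :
    ∃ C : ℝ, ∀ (d : ℕ) (D : Set (EuclideanSpace ℝ (Fin d))) (_ : IsCompact D)
      (H : Type*) [NormedAddCommGroup H] [InnerProductSpace ℝ H] [CompleteSpace H] [RKHS ℝ H D ℝ]
      (HD : Type*) [NormedAddCommGroup HD] [InnerProductSpace ℝ HD] [CompleteSpace HD]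
      [RKHS ℝ HD (D × D) ℝ]
      (_ : DuelingIDS.scalarKernel HD = DuelingIDS.duelingKernel (DuelingIDS.scalarKernel H))
      (_ : Measurable fun q : D × D => DuelingIDS.scalarKernel H q.1 q.2)
      (_ : ∀ a : D, DuelingIDS.scalarKernel H a a ≤ 1)
      (f : H) (_ : ‖f‖ ≤ B) (xs : D) (_ : ∀ a : D, f a ≤ f xs)
      (δ : ℝ) (_ : 0 < δ) (_ : δ ≤ 1)
      (L κ : ℝ) (_ : L = DuelingIDS.sigmoidLip (2 * B)) (_ : κ = DuelingIDS.sigmoidKappa (2 * B))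
      (β : ℕ → ℝ) (_ : β = DuelingIDS.confCoef (DuelingIDS.scalarKernel HD) L κ lam B δ)
      (Ω : Type*) (mΩ : MeasurableSpace Ω) (μ : Measure Ω) [IsProbabilityMeasure μ]
      (𝒢 : Filtration ℕ mΩ) (xnull : D)
      (h : ℕ → Ω → HD) (x₁ x₂ : ℕ → Ω → D) (p : ℕ → Ω → ℝ) (α : ℕ → Ω → Bool)
      (x x' : ℕ → Ω → D) (y : ℕ → Ω → Bool)
      (_ : DuelingIDS.IsIDSRun μ 𝒢 f B lam κ (fun n => β (n + 1) / L) xnull h x₁ x₂ p α x x' y),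
      ENNReal.ofReal (1 - δ) ≤ μ {ω | ∀ T : ℕ,
        DuelingIDS.duelingRegret f xs (fun n => x n ω) (fun n => x' n ω) T ≤
            C * β T * √(T * (DuelingIDS.infoGain (DuelingIDS.scalarKernel H) (lam * κ) T
              + Real.log (1 / δ))) ∧
        DuelingIDS.duelingRegret f xs (fun n => x n ω) (fun n => x' n ω) T ≤
            C * β T * √(T * (DuelingIDS.infoGain (DuelingIDS.scalarKernel HD) (lam * κ) T
              + Real.log (1 / δ)))} := by
  -- The factor 2 is √4, from the comparison of the dueling gain with four times the gain of k.
  refine ⟨2 * DuelingIDS.regretConst B lam, ?_⟩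
  intro d D _ H _ _ _ _ HD _ _ _ _ hk hkm h1 f hfB xs hxs δ hδ hδ1 L κ hL hκ β hβ Ω mΩ μ _ 𝒢 xnull
    h x₁ x₂ p α x x' y hrun
  have hB : 0 ≤ B := (norm_nonneg f).trans hfB
  have : Nonempty D := ⟨xs⟩
  have hκ0 : 0 < κ := hκ ▸ DuelingIDS.sigmoidKappa_pos (by linarith)
  have hL0 : 0 < L := hL ▸ DuelingIDS.sigmoidLip_pos (by linarith)
  have hρ : 0 < lam * κ := mul_pos hlam hκ0
  have hker := DuelingIDS.scalarKernel_dueling_le hk h1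
  obtain ⟨F, hFn, hFf⟩ := DuelingIDS.exists_dueling_function hk f
  have hF : ‖F‖ ≤ B := hFn.trans hfB
  have hgapB : ∀ a, f xs - f a ≤ 2 * B := fun a => by
    have hbound : ∀ b : D, |f b| ≤ B := fun b => by
      refine (DuelingIDS.abs_apply_le f b).trans ?_
      calc _ ≤ B * 1 := mul_le_mul hfB (Real.sqrt_le_iff.mpr ⟨zero_le_one, by simpa using h1 b⟩)
            (Real.sqrt_nonneg _) hB
        _ = B := mul_one B
    linarith [(abs_le.mp (hbound xs)).2, (abs_le.mp (hbound a)).1]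
  have hkDm : Measurable fun q : (D × D) × (D × D) => DuelingIDS.scalarKernel HD q.1 q.2 := by
    rw [hk]
    exact DuelingIDS.measurable_duelingKernel hkm
  have hfm : Measurable fun a => f a := DuelingIDS.measurable_of_measurable_kernel hkm f
  have hevent := hrun.measure_ge hkDm hker hfm hxs hB hgapB hFf hρ rfl hδ
  set S := {ω | ∃ T, ∃ i : Fin 3, Real.log (3 / δ) ≤ ∑ n ∈ Finset.range T, _} with hS
  have hcompl : ENNReal.ofReal (1 - δ) ≤ μ Sᶜ := by
    -- Subadditivity suffices, so measurability of S is not needed.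
    have h2 : 1 ≤ μ S + μ Sᶜ := by
      rw [← measure_univ (μ := μ), ← Set.union_compl_self S]
      exact measure_union_le _ _
    rw [ENNReal.ofReal_sub _ hδ.le, ENNReal.ofReal_one]
    exact tsub_le_iff_left.mpr (h2.trans (add_le_add_left hevent _))
  refine hcompl.trans (measure_mono_ae ?_)
  filter_upwards [hrun.estimate, hrun.choice] with ω hest hchoice hω T
  have hω' : ∀ T, ∀ i : Fin 3, _ < Real.log (3 / δ) := fun T i =>
    not_le.mp fun hle => hω ⟨T, i, hle⟩
  have hmain := DuelingIDS.duelingRegret_le hB hlam hδ hδ1 hk hker hxs hF hFf hL hκ rfl rfl hβ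
    (fun n => hrun.play_fst n ω) (fun n => hrun.play_snd n ω) hest hchoice
    (fun T => (hω' T 0).le) (fun T => (hω' T 1).le) (fun T => (hω' T 2).le) T
  have hΓ0 := DuelingIDS.infoGain_nonneg (H := H) hρ h1 T
  have hΓD := DuelingIDS.infoGain_dueling_le hk hρ h1 T
  have hℓ0 : 0 ≤ Real.log (1 / δ) := Real.log_nonneg (by rw [le_div_iff₀ hδ]; linarith)
  have hβ0 : 0 ≤ β T := by
    rw [hβ, DuelingIDS.confCoef]
    positivity
  have hC0 := DuelingIDS.regretConst_nonneg (lam := lam) hB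
  constructor
  · refine hmain.trans ?_
    calc _ ≤ DuelingIDS.regretConst B lam * β T *
          √(2 ^ 2 * (T * (DuelingIDS.infoGain (DuelingIDS.scalarKernel H) (lam * κ) T
            + Real.log (1 / δ)))) := by
          refine mul_le_mul_of_nonneg_left (Real.sqrt_le_sqrt ?_) (by positivity)
          have hT0 : (0 : ℝ) ≤ T := Nat.cast_nonneg T
          nlinarith
      _ = _ := by
          rw [Real.sqrt_mul (by positivity), Real.sqrt_sq (by norm_num)]
          ring
  · refine hmain.trans ?_
    gcongr
    linarith
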